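/- Let $B\subset\mathbb{R}^n$ be an open set and let $\pi:(M,\omega)\to B$ be a Lagrangian fibration with connected fibres: $(M,\omega)$ is a (Hausdorff, second countable) symplectic manifold, $\pi$ is a surjective smooth submersion, and every fibre $\pi^{-1}(b)$ is a connected Lagrangian submanifold of $(M,\omega)$. For a $1$-form $\alpha$ on $B$ let $X_{\pi^*\alpha}$ be the vector field on $M$ defined by $\omega(X_{\pi^*\alpha},\cdot)=\pi^*\alpha$, and suppose that the fibration is complete: for every smooth compactly supported $1$-form $\alpha$ on $B$ the vector field $X_{\pi^*\alpha}$ is complete; let $\phi^t_\alpha$ be its flow. For $b\in B$ and $\beta\in T_b^*B$ the restriction $\phi^1_\beta:=\phi^1_\alpha|_{\pi^{-1}(b)}$, where $\alpha$ is any compactly supported $1$-form with $\alpha(b)=\beta$, does not depend on the choice of $\alpha$. Put $$\Lambda_b:=\{\beta\in T_b^*B \ |\ \phi^1_\beta(m)=m \ \text{ for all } m\in\pi^{-1}(b)\},\qquad \Lambda:=\bigcup_{b\in B}\Lambda_b\subset T^*B .$$ The set $\Lambda$ is called the period net of the fibration. Then: (1) $\Lambda$ is a closed (embedded) Lagrangian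 submanifold of $T^*B$ with its canonical symplectic form. (2) The relation on $T^*B$ which identifies two covectors when they lie over the same point $b\in B$ and their difference belongs to $\Lambda_b$ is an equivalence relation, and the quotient $T^*B/\Lambda$ is a smooth manifold: with the quotient topology it is Hausdorff and second countable, and it carries a smooth structure of dimension $2n$ for which the quotient map $T^*B\to T^*B/\Lambda$ is a local diffeomorphism. -/

import Mathlib

open scoped Manifold ContDiff Topology
open TopologicalSpace

noncomputable section

/-- A subspace `W` is Lagrangian for the bilinear form `Ω` if it equals its own
`Ω`-orthogonal complement. -/
def IsLagrangianSubspace {F : Type*} [AddCommGroup F] [Module ℝ F] (Ω : F → F → ℝ)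
    (W : Submodule ℝ F) : Prop :=
  ∀ v : F, v ∈ W ↔ ∀ w ∈ W, Ω v w = 0

section Symplectic

variable (E : Type*) [NormedAddCommGroup E] [NormedSpace ℝ E]
  (M : Type*) [TopologicalSpace M] [ChartedSpace E M]

/-- A (not necessarily continuous) field of alternating `2`-forms on the tangent spaces of `M`. -/
abbrev TwoFormField : Type _ := ∀ x : M, (TangentSpace 𝓘(ℝ, E) x) [⋀^Fin 2]→L[ℝ] ℝ

variable {E M}

/-- The expression of a `2`-form in the chart `e`: its pullback under `e.symm`
(meaningful on `e.target`). -/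
def twoFormInChart (σ : TwoFormField E M) (e : OpenPartialHomeomorph M E) (y : E) :
    E [⋀^Fin 2]→L[ℝ] ℝ :=
  (σ (e.symm y)).compContinuousLinearMap (mfderiv 𝓘(ℝ, E) 𝓘(ℝ, E) e.symm y)

variable (E M)

/-- A symplectic form on the manifold `M`: a smooth, closed, nondegenerate `2`-form. Smoothness and
closedness are expressed in the charts of the smooth structure of `M`. -/
structure SymplecticForm where
  toForm : TwoFormField E M
  smooth : ∀ e ∈ IsManifold.maximalAtlas 𝓘(ℝ, E) ∞ M,
    ContDiffOn ℝ ∞ (twoFormInChart toForm e) e.target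
  closed : ∀ e ∈ IsManifold.maximalAtlas 𝓘(ℝ, E) ∞ M,
    ∀ y ∈ e.target, extDeriv (twoFormInChart toForm e) y = 0
  nondegenerate : ∀ (x : M) (v : TangentSpace 𝓘(ℝ, E) x),
    (∀ w : TangentSpace 𝓘(ℝ, E) x, toForm x ![v, w] = 0) → v = 0

end Symplectic

section Cotangent

variable {n : ℕ}

/-- The cotangent bundle `T^*B` of an open subset `B` of `ℝⁿ`, which is `B × (ℝⁿ)^*`,
with the product manifold structure. A point is a pair `(b, β)` with `β ∈ T_b^*B = (ℝⁿ)^*`. -/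
abbrev CotangentBundle (B : Opens (EuclideanSpace ℝ (Fin n))) : Type :=
  B × StrongDual ℝ (EuclideanSpace ℝ (Fin n))

/-- The model space of the manifold `T^*B`. -/
abbrev CotangentModel (n : ℕ) : Type :=
  ModelProd (EuclideanSpace ℝ (Fin n)) (StrongDual ℝ (EuclideanSpace ℝ (Fin n)))

/-- The model (without boundary) of the manifold `T^*B`. -/
abbrev cotangentI (n : ℕ) :
    ModelWithCorners ℝ (EuclideanSpace ℝ (Fin n) × StrongDual ℝ (EuclideanSpace ℝ (Fin n)))
      (CotangentModel n) :=
  𝓘(ℝ, EuclideanSpace ℝ (Fin n)).prod 𝓘(ℝ, StrongDual ℝ (EuclideanSpace ℝ (Fin n)))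

/-- The canonical symplectic form `∑ dqᵢ ∧ dpᵢ` of `T^*B = B × (ℝⁿ)^*`, at any of its points:
on tangent vectors `v = (v_q, v_p)` and `w = (w_q, w_p)` it is `w_p(v_q) - v_p(w_q)`. -/
def canonicalForm (n : ℕ)
    (v w : EuclideanSpace ℝ (Fin n) × StrongDual ℝ (EuclideanSpace ℝ (Fin n))) : ℝ :=
  w.2 v.1 - v.2 w.1

/-- `L ⊆ T^*B` is a (smoothly embedded) Lagrangian submanifold: with its subspace topology it
carries a smooth structure of dimension `n` for which the inclusion is a smooth embedding, and each
of its tangent spaces is a Lagrangian subspace for the canonical symplectic form. -/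
def IsLagrangianSubmanifold {B : Opens (EuclideanSpace ℝ (Fin n))}
    (L : Set (CotangentBundle B)) : Prop :=
  ∃ _ : ChartedSpace (EuclideanSpace ℝ (Fin n)) L,
    IsManifold 𝓘(ℝ, EuclideanSpace ℝ (Fin n)) ∞ L ∧
    Manifold.IsSmoothEmbedding 𝓘(ℝ, EuclideanSpace ℝ (Fin n)) (cotangentI n) ∞
      (Subtype.val : L → CotangentBundle B) ∧
    ∀ x : L, IsLagrangianSubspace (canonicalForm n)
      (LinearMap.range (mfderiv 𝓘(ℝ, EuclideanSpace ℝ (Fin n)) (cotangentI n)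
        (Subtype.val : L → CotangentBundle B) x).toLinearMap)

/-- A smooth compactly supported `1`-form on `B`, as a map `B → (ℝⁿ)^*`. -/
structure CompactOneForm (B : Opens (EuclideanSpace ℝ (Fin n))) where
  toFun : B → StrongDual ℝ (EuclideanSpace ℝ (Fin n))
  smooth : ContMDiff 𝓘(ℝ, EuclideanSpace ℝ (Fin n))
    𝓘(ℝ, StrongDual ℝ (EuclideanSpace ℝ (Fin n))) ∞ toFun
  compactSupport : HasCompactSupport toFun

end Cotangent

/-- A Lagrangian fibration `π : (M, ω) → B` over an open subset `B` of `ℝⁿ`: a surjective smooth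
submersion from a symplectic manifold with Lagrangian fibres. As `π` is a submersion, the tangent
space at `x` of the fibre through `x` is the kernel of `dπ_x`. -/
structure LagrangianFibration {n : ℕ} (B : Opens (EuclideanSpace ℝ (Fin n)))
    (E : Type*) [NormedAddCommGroup E] [NormedSpace ℝ E]
    (M : Type*) [TopologicalSpace M] [ChartedSpace E M] where
  symplecticForm : SymplecticForm E M
  proj : M → B
  surjective : Function.Surjective proj
  submersion : Manifold.IsSubmersion 𝓘(ℝ, E) 𝓘(ℝ, EuclideanSpace ℝ (Fin n)) ∞ proj
  lagrangian_fibres : ∀ x : M,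
    IsLagrangianSubspace (fun v w : TangentSpace 𝓘(ℝ, E) x => symplecticForm.toForm x ![v, w])
      (LinearMap.ker (mfderiv 𝓘(ℝ, E) 𝓘(ℝ, EuclideanSpace ℝ (Fin n)) proj x).toLinearMap)

namespace LagrangianFibration

variable {n : ℕ} {B : Opens (EuclideanSpace ℝ (Fin n))}
  {E : Type*} [NormedAddCommGroup E] [NormedSpace ℝ E] [FiniteDimensional ℝ E]
  {M : Type*} [TopologicalSpace M] [ChartedSpace E M]

/-- Nondegeneracy: for every `β ∈ (ℝⁿ)^*` and `x : M` there is exactly one tangent vector `X` at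
`x` with `ω(X, ·) = β ∘ dπ_x`. -/
theorem existsUnique_vector (F : LagrangianFibration B E M)
    (β : StrongDual ℝ (EuclideanSpace ℝ (Fin n))) (x : M) :
    ∃! X : TangentSpace 𝓘(ℝ, E) x, ∀ v : TangentSpace 𝓘(ℝ, E) x,
      F.symplecticForm.toForm x ![X, v] =
        β (mfderiv 𝓘(ℝ, E) 𝓘(ℝ, EuclideanSpace ℝ (Fin n)) F.proj x v) := by
  have : FiniteDimensional ℝ (TangentSpace 𝓘(ℝ, E) x) := inferInstanceAs (FiniteDimensional ℝ E)
  have upd1 : ∀ a b c : TangentSpace 𝓘(ℝ, E) x, Function.update ![a, b] 0 c = ![c, b] := by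
    intro a b c; ext i; fin_cases i <;> simp
  have upd2 : ∀ a b c : TangentSpace 𝓘(ℝ, E) x, Function.update ![a, b] 1 c = ![a, c] := by
    intro a b c; ext i; fin_cases i <;> simp
  let L : TangentSpace 𝓘(ℝ, E) x →ₗ[ℝ] TangentSpace 𝓘(ℝ, E) x →ₗ[ℝ] ℝ :=
    LinearMap.mk₂ ℝ (fun v w => F.symplecticForm.toForm x ![v, w])
      (fun a b w => by
        have h := (F.symplecticForm.toForm x).map_update_add ![0, w] 0 a b
        simpa only [upd1] using h)
      (fun c a w => by
        have h := (F.symplecticForm.toForm x).map_update_smul ![0, w] 0 c a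
        simpa only [upd1] using h)
      (fun v a b => by
        have h := (F.symplecticForm.toForm x).map_update_add ![v, 0] 1 a b
        simpa only [upd2] using h)
      (fun c v a => by
        have h := (F.symplecticForm.toForm x).map_update_smul ![v, 0] 1 c a
        simpa only [upd2] using h)
  have hinj : Function.Injective L := by
    rw [← LinearMap.ker_eq_bot, LinearMap.ker_eq_bot']
    intro v hv
    exact F.symplecticForm.nondegenerate x v fun w => LinearMap.congr_fun hv w
  have hsurj : Function.Surjective L :=
    (LinearMap.injective_iff_surjective_of_finrank_eq_finrank
      (Subspace.dual_finrank_eq (K := ℝ) (V := TangentSpace 𝓘(ℝ, E) x)).symm).1 hinj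
  obtain ⟨X, hX⟩ := hsurj (β.toLinearMap ∘ₗ
    (mfderiv 𝓘(ℝ, E) 𝓘(ℝ, EuclideanSpace ℝ (Fin n)) F.proj x).toLinearMap)
  refine ⟨X, fun v => LinearMap.congr_fun hX v, fun Y hY => hinj ?_⟩
  rw [hX]
  exact LinearMap.ext hY

/-- The vector field `X_{π^*α}` on `M`, defined by `ω(X_{π^*α}, ·) = π^*α`. -/
def vectorField (F : LagrangianFibration B E M) (α : CompactOneForm B) (x : M) :
    TangentSpace 𝓘(ℝ, E) x :=
  (F.existsUnique_vector (α.toFun (F.proj x)) x).choose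

/-- The Lagrangian fibration is complete: for each compactly supported `1`-form `α` on `B` the
vector field `X_{π^*α}` is complete, that is, through every point of `M` there passes an integral
curve defined for all times. -/
def IsComplete (F : LagrangianFibration B E M) : Prop :=
  ∀ (α : CompactOneForm B) (x : M), ∃ γ : ℝ → M,
    γ 0 = x ∧ IsMIntegralCurve (I := 𝓘(ℝ, E)) γ (F.vectorField α)

/-- The flow `φ_α^t` of `X_{π^*α}`; the integral curve through a point is unique when `M` is
Hausdorff. -/
def flow (F : LagrangianFibration B E M) (hF : F.IsComplete) (α : CompactOneForm B) (t : ℝ)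
    (x : M) : M :=
  (hF α x).choose t

/-- The period lattice `Λ_b ⊆ T_b^*B`: the covectors `β` such that `φ_β^1` is the identity of
`π⁻¹(b)`, where `φ_β^1` is the restriction of `φ_α^1` to `π⁻¹(b)` for a compactly supported
`1`-form `α` with `α(b) = β`. As `X_{π^*α}` depends on `π⁻¹(b)` only on `α(b)` and is tangent to
the fibres, the choice of `α` is irrelevant. -/
def periodLattice (F : LagrangianFibration B E M) (hF : F.IsComplete) (b : B) :
    Set (StrongDual ℝ (EuclideanSpace ℝ (Fin n))) :=
  {β | ∃ α : CompactOneForm B, α.toFun b = β ∧ ∀ x : M, F.proj x = b → F.flow hF α 1 x = x}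

/-- The period net `Λ = ⋃_b Λ_b ⊆ T^*B`. -/
def periodNet (F : LagrangianFibration B E M) (hF : F.IsComplete) : Set (CotangentBundle B) :=
  {ξ | ξ.2 ∈ F.periodLattice hF ξ.1}

/-- Two covectors are identified in `T^*B/Λ` if they lie over the same point of `B` and their
difference belongs to `Λ`. -/
def PeriodRel (F : LagrangianFibration B E M) (hF : F.IsComplete) (ξ η : CotangentBundle B) :
    Prop :=
  ξ.1 = η.1 ∧ ξ.2 - η.2 ∈ F.periodLattice hF ξ.1

/-- The quotient `T^*B/Λ`, with the quotient topology. -/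
abbrev PeriodQuotient (F : LagrangianFibration B E M) (hF : F.IsComplete) : Type :=
  Quot (F.PeriodRel hF)

end LagrangianFibration

end

/-! Nondegeneracy of ω and the Lagrangian fibres make β ↦ X_β an isomorphism of T_b^*B onto the
vertical tangent space at each point over b (`dbase_hamVec`, `eq_zero_of_hamVec_eq_zero`,
`exists_hamVec_eq`). Completeness gives time-one maps φ_β of these fields on all of M, for constant
covectors β, smooth in (β, m) (`contMDiff_timeOne`). Cartan's formula shows that φ_β preserves ω
(`form_timeOne`). It also preserves π, hence every X_γ, so the flows commute and β ↦ φ_β is an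
action of the vector group (ℝⁿ)^* (`timeOne_add`). Its orbits are open in the fibres, which are
connected, so it is transitive on each fibre (`exists_timeOne_eq`). As the group is abelian, all
points over b have the same stabilizer, and this is Λ_b.

For a local section s, the map (b, β) ↦ φ_β(s b) is a local diffeomorphism
(`exists_fibre_coordinate`). Near a given period the equation φ_β(s b) = s b therefore has exactly
one solution β = l(b) over each b, and Λ is locally the graph of a smooth 1-form l
(`exists_periodSet_eq_graph`). Differentiating the identity φ_{l(π m)}(m) = m and using that φ is
symplectic makes dl symmetric, so l is closed and its graph is Lagrangian
(`fderiv_symm_of_mem_periodSet`). The same equation is a closed condition on (b, β), so Λ is closed.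

For the quotient, closedness of Λ gives the Hausdorff property. Near the zero section Λ is the zero
section alone, so the quotient map is locally injective. Translations by the local forms l preserve
the classes; they make the quotient map open and the transition maps smooth (`HasSmoothDeck`). -/

noncomputable section

/-! ### Superposition operators on spaces of continuous functions. -/

section Nemytskii

universe u

variable {K : Type*} [TopologicalSpace K] [CompactSpace K]

/-- The pointwise extension of a continuous bilinear map to continuous functions on a compact
space. -/
def ContinuousMap.pointwiseBilinear (K : Type*) [TopologicalSpace K] [CompactSpace K]
    {G E F : Type*} [NormedAddCommGroup G] [NormedSpace ℝ G] [NormedAddCommGroup E]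
    [NormedSpace ℝ E] [NormedAddCommGroup F] [NormedSpace ℝ F] (B : G →L[ℝ] E →L[ℝ] F) :
    C(K, G) →L[ℝ] C(K, E) →L[ℝ] C(K, F) :=
  LinearMap.mkContinuous₂
    (LinearMap.mk₂ ℝ
      (fun (A : C(K, G)) (h : C(K, E)) => (⟨fun t => B (A t) (h t), by fun_prop⟩ : C(K, F)))
      (fun A A' h => by ext t; simp) (fun c A h => by ext t; simp)
      (fun A h h' => by ext t; simp) (fun c A h => by ext t; simp)) ‖B‖
    (fun A h => by
      refine (ContinuousMap.norm_le _ (by positivity)).2 fun t => ?_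
      refine (B.le_opNorm₂ (A t) (h t)).trans ?_
      gcongr
      exacts [A.norm_coe_le_norm t, h.norm_coe_le_norm t])

theorem ContinuousMap.contDiff_pointwiseBilinear {G E F : Type*} [NormedAddCommGroup G]
    [NormedSpace ℝ G] [NormedAddCommGroup E] [NormedSpace ℝ E]
    [NormedAddCommGroup F] [NormedSpace ℝ F] (B : G →L[ℝ] E →L[ℝ] F) {m : WithTop ℕ∞} :
    ContDiff ℝ m fun A : C(K, G) => ContinuousMap.pointwiseBilinear K B A :=
  (ContinuousMap.pointwiseBilinear K B).contDiff

/-- The derivative of v is uniformly continuous near the compact range of f, so the mean value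
inequality bounds the remainder uniformly in t. Encoding the derivative as `B (v' x)` keeps it in
the form that the bilinear parametrization needs. -/
theorem ContinuousMap.hasFDerivAt_comp_left {G E F : Type*} [NormedAddCommGroup G]
    [NormedSpace ℝ G] [NormedAddCommGroup E] [NormedSpace ℝ E]
    [NormedAddCommGroup F] [NormedSpace ℝ F] (B : G →L[ℝ] E →L[ℝ] F) (v : C(E, F)) (v' : C(E, G))
    (hv : ∀ x, HasFDerivAt v (B (v' x)) x) (f : C(K, E)) :
    HasFDerivAt (fun f : C(K, E) => v.comp f)
      (ContinuousMap.pointwiseBilinear K B (v'.comp f)) f := by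
  rw [hasFDerivAt_iff_isLittleO, Asymptotics.isLittleO_iff]
  intro c hc
  have hK : IsCompact (Set.range f) := isCompact_range f.continuous
  have huc := hK.uniformContinuousAt_of_continuousAt (fun x => B (v' x))
    (fun x _ => (B.continuous.comp v'.continuous).continuousAt) (Metric.dist_mem_uniformity hc)
  obtain ⟨δ, hδ, hδ'⟩ := Metric.mem_uniformity_dist.1 huc
  filter_upwards [Metric.ball_mem_nhds f hδ] with g hg
  refine (ContinuousMap.norm_le _ (by positivity)).2 fun t => ?_
  have hgt : g t ∈ Metric.ball (f t) δ :=
    lt_of_le_of_lt (ContinuousMap.dist_apply_le_dist t) hg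
  have hmv := (convex_ball (f t) δ).norm_image_sub_le_of_norm_hasFDerivWithin_le' (f := v)
    (f' := fun x => B (v' x)) (φ := B (v' (f t))) (C := c) (x := f t) (y := g t)
    (fun x _ => (hv x).hasFDerivWithinAt)
    (fun x hx => by
      have := hδ' (a := f t) (b := x) (by rwa [dist_comm]) ⟨t, rfl⟩
      have h2 : dist (B (v' (f t))) (B (v' x)) < c := this
      rw [dist_comm, dist_eq_norm] at h2
      exact h2.le)
    (Metric.mem_ball_self hδ) hgt
  refine hmv.trans (mul_le_mul_of_nonneg_left ?_ hc.le)
  exact (g - f).norm_coe_le_norm t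

/-- The derivative is composition with v' followed by a continuous linear operator, so it is as
regular as composition with v'. -/
theorem ContinuousMap.contDiff_succ_comp_left {G E F : Type*} [NormedAddCommGroup G]
    [NormedSpace ℝ G] [NormedAddCommGroup E] [NormedSpace ℝ E]
    [NormedAddCommGroup F] [NormedSpace ℝ F] (B : G →L[ℝ] E →L[ℝ] F) (v : C(E, F)) (v' : C(E, G))
    (hv : ∀ x, HasFDerivAt v (B (v' x)) x) {m : ℕ}
    (hm : ContDiff ℝ m fun f : C(K, E) => v'.comp f) :
    ContDiff ℝ (m + 1 : ℕ) fun f : C(K, E) => v.comp f := by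
  have hd := ContinuousMap.hasFDerivAt_comp_left (K := K) B v v' hv
  have h2 : ContDiff ℝ ((m : ℕ∞) + 1 : WithTop ℕ∞) (fun f : C(K, E) => v.comp f) := by
    rw [contDiff_succ_iff_fderiv]
    refine ⟨fun f => (hd f).differentiableAt, by simp, ?_⟩
    rw [show fderiv ℝ (fun f : C(K, E) => v.comp f) =
      fun f => ContinuousMap.pointwiseBilinear K B (v'.comp f) from funext fun f => (hd f).fderiv]
    exact (ContinuousMap.contDiff_pointwiseBilinear B).comp hm
  exact_mod_cast h2

/-- The induction passes from v to its derivative, whose values lie in `E →L[ℝ] F`. Hence F must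
vary, and E and F share a universe. -/
theorem ContinuousMap.contDiff_comp_left_nat {E : Type u} [NormedAddCommGroup E] [NormedSpace ℝ E]
    (m : ℕ) : ∀ {F : Type u} [NormedAddCommGroup F] [NormedSpace ℝ F] (v : C(E, F)),
    ContDiff ℝ m v → ContDiff ℝ m (fun f : C(K, E) => v.comp f) := by
  induction m with
  | zero =>
    intro F _ _ v _
    exact contDiff_zero.2 (ContinuousMap.continuous_postcomp v)
  | succ m ih =>
    intro F _ _ v hv
    have hv' : ContDiff ℝ ((m : ℕ∞) + 1 : WithTop ℕ∞) v := by exact_mod_cast hv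
    have h1 := contDiff_succ_iff_fderiv.1 hv'
    exact ContinuousMap.contDiff_succ_comp_left (ContinuousLinearMap.id ℝ _) v
      ⟨fderiv ℝ v, h1.2.2.continuous⟩ (fun x => (h1.1 x).hasFDerivAt) (ih _ h1.2.2)

/-- Composition on the left with a smooth map is a smooth map between spaces of continuous
functions on a compact space. -/
theorem ContinuousMap.contDiff_comp_left {E F : Type u} [NormedAddCommGroup E] [NormedSpace ℝ E]
    [NormedAddCommGroup F] [NormedSpace ℝ F] (v : C(E, F))
    (hv : ContDiff ℝ ∞ v) : ContDiff ℝ ∞ (fun f : C(K, E) => v.comp f) :=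
  contDiff_infty.2 fun m => ContinuousMap.contDiff_comp_left_nat m v (contDiff_infty.1 hv m)

theorem ContinuousMap.contDiff_const {m : WithTop ℕ∞} (G : Type*) [NormedAddCommGroup G]
    [NormedSpace ℝ G] : ContDiff ℝ m fun x : G => ContinuousMap.const K x :=
  (LinearMap.mkContinuous
    { toFun := fun x : G => ContinuousMap.const K x
      map_add' := fun _ _ => rfl
      map_smul' := fun _ _ => rfl } 1
    (fun x => (ContinuousMap.norm_le _ (by positivity)).2 fun _ => by rw [one_mul]; exact le_rfl)).contDiff

end Nemytskii

/-! ### Smooth local flows from the implicit function theorem. -/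

section LocalFlow

universe u

/-- The operator sending `g` to its primitive vanishing at `0`, on continuous functions on
`[-2, 2]`. -/
def primitiveL (E : Type*) [NormedAddCommGroup E] [NormedSpace ℝ E] [CompleteSpace E] :
    C(Set.Icc (-2 : ℝ) 2, E) →L[ℝ] C(Set.Icc (-2 : ℝ) 2, E) :=
  have hc : ∀ g : C(Set.Icc (-2 : ℝ) 2, E),
      Continuous fun s : ℝ => g (Set.projIcc (-2) 2 (by norm_num) s) := fun g =>
    g.continuous.comp continuous_projIcc
  LinearMap.mkContinuous
    { toFun := fun g => ⟨fun t => ∫ s in (0 : ℝ)..t, g (Set.projIcc (-2) 2 (by norm_num) s),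
        (intervalIntegral.continuous_primitive
          (fun a b => (hc g).intervalIntegrable a b) 0).comp continuous_subtype_val⟩
      map_add' := fun g g' => by
        ext t
        exact intervalIntegral.integral_add ((hc g).intervalIntegrable _ _)
          ((hc g').intervalIntegrable _ _)
      map_smul' := fun c g => by
        ext t
        exact intervalIntegral.integral_smul c _ } 2
    (fun g => by
      refine (ContinuousMap.norm_le _ (by positivity)).2 fun t => ?_
      refine (intervalIntegral.norm_integral_le_of_norm_le_const (C := ‖g‖)
        fun s _ => g.norm_coe_le_norm _).trans ?_
      rw [mul_comm, sub_zero]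
      exact mul_le_mul_of_nonneg_right (abs_le.2 ⟨t.2.1, t.2.2⟩) (norm_nonneg _))

theorem primitiveL_apply {E : Type*} [NormedAddCommGroup E] [NormedSpace ℝ E] [CompleteSpace E]
    (g : C(Set.Icc (-2 : ℝ) 2, E)) (t : Set.Icc (-2 : ℝ) 2) :
    primitiveL E g t = ∫ s in (0 : ℝ)..t, g (Set.projIcc (-2) 2 (by norm_num) s) := rfl

/-- Smooth dependence on parameters and initial values: if `X` is a smooth field with values in a
space `G` that parametrizes linear maps `V → E`, then for small `β` the time-one map of the vector
field `X(·) β` is smooth in `β` and in the initial value. -/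
theorem exists_contDiffAt_localFlow {E : Type u} [NormedAddCommGroup E] [NormedSpace ℝ E]
    [FiniteDimensional ℝ E] {V : Type*} [NormedAddCommGroup V] [NormedSpace ℝ V] [CompleteSpace V]
    {G : Type u} [NormedAddCommGroup G] [NormedSpace ℝ G] (B : G →L[ℝ] V →L[ℝ] E)
    {X : E → G} {U : Set E} (hU : IsOpen U) (hX : ContDiffOn ℝ ∞ X U) {y₀ : E}
    (hy₀ : y₀ ∈ U) :
    ∃ Φ : V × E → E, ContDiffAt ℝ ∞ Φ (0, y₀) ∧ ∀ᶠ q in 𝓝 ((0 : V), y₀), ∃ c : ℝ → E,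
      c 0 = q.2 ∧ c 1 = Φ q ∧
      ∀ t ∈ Set.Ioo (-2 : ℝ) 2, c t ∈ U ∧ HasDerivAt c (B (X (c t)) q.1) t := by
  have : CompleteSpace E := FiniteDimensional.complete ℝ E
  obtain ⟨r, hr, hrU⟩ := Metric.isOpen_iff.1 hU y₀ hy₀
  -- The cut-off makes the field globally smooth without changing it on the ball of radius r / 3,
  -- where the solutions will be kept.
  let χ : ContDiffBump y₀ := ⟨r / 3, r / 2, by positivity, by linarith⟩
  have hX' : ContDiff ℝ ∞ fun y => χ y • X y := by
    rw [contDiff_iff_contDiffAt]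
    intro y
    by_cases hy : y ∈ U
    · exact χ.contDiff.contDiffAt.smul (hX.contDiffAt (hU.mem_nhds hy))
    · have : (fun y => χ y • X y) =ᶠ[𝓝 y] fun _ => 0 := by
        have hy' : y ∉ tsupport χ := fun h => hy (hrU (by
          rw [χ.tsupport_eq] at h
          exact Metric.closedBall_subset_ball (by change r / 2 < r; linarith) h))
        filter_upwards [(isClosed_tsupport χ).isOpen_compl.mem_nhds hy'] with z hz
        rw [image_eq_zero_of_notMem_tsupport hz, zero_smul]
      exact contDiffAt_const.congr_of_eventuallyEq this
  let X' : C(E, G) := ⟨_, hX'.continuous⟩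
  -- Zeros of P are the solutions of the integral equation with parameter q.1.1 and initial value
  -- q.1.2. The interval [-2, 2] has both 0 and 1 in its interior; smallness of the parameter
  -- replaces smallness of time.
  let P : (V × E) × C(Set.Icc (-2 : ℝ) 2, E) → C(Set.Icc (-2 : ℝ) 2, E) := fun q =>
    q.2 - ContinuousMap.const _ q.1.2 - primitiveL E
      (ContinuousMap.pointwiseBilinear _ B (X'.comp q.2) (ContinuousMap.const _ q.1.1))
  have hP : ContDiff ℝ ∞ P := by
    have h1 : ContDiff ℝ ∞ fun q : (V × E) × C(Set.Icc (-2 : ℝ) 2, E) => X'.comp q.2 :=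
      (ContinuousMap.contDiff_comp_left X' hX').comp contDiff_snd
    have h2 : ContDiff ℝ ∞ fun q : (V × E) × C(Set.Icc (-2 : ℝ) 2, E) =>
        ContinuousMap.const (Set.Icc (-2 : ℝ) 2) q.1.2 :=
      (ContinuousMap.contDiff_const _).comp (contDiff_snd.comp contDiff_fst)
    have h3 : ContDiff ℝ ∞ fun q : (V × E) × C(Set.Icc (-2 : ℝ) 2, E) =>
        ContinuousMap.const (Set.Icc (-2 : ℝ) 2) q.1.1 :=
      (ContinuousMap.contDiff_const _).comp (contDiff_fst.comp contDiff_fst)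
    have h4 : ContDiff ℝ ∞ fun q : (V × E) × C(Set.Icc (-2 : ℝ) 2, E) =>
        ContinuousMap.pointwiseBilinear _ B (X'.comp q.2) :=
      (ContinuousMap.contDiff_pointwiseBilinear B).comp h1
    exact (contDiff_snd.sub h2).sub ((primitiveL E).contDiff.comp (h4.clm_apply h3))
  -- At parameter 0 the integral term vanishes, so the partial derivative in the curve is the
  -- identity.
  have h2 : ∀ f, P ((0, y₀), f) = f - ContinuousMap.const _ y₀ := by
    intro f
    ext t
    simp [P]
  let u₀ : (V × E) × C(Set.Icc (-2 : ℝ) 2, E) := ((0, y₀), ContinuousMap.const _ y₀)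
  have hfd : fderiv ℝ P u₀ ∘L .inr ℝ _ _ = ContinuousLinearMap.id ℝ _ := by
    have h3 : HasFDerivAt (fun f => P ((0, y₀), f)) (fderiv ℝ P u₀ ∘L .inr ℝ _ _) u₀.2 :=
      ((hP.differentiable (by simp) u₀).hasFDerivAt).comp u₀.2 (hasFDerivAt_prodMk_right _ _)
    have h4 : HasFDerivAt (fun f => P ((0, y₀), f)) (ContinuousLinearMap.id ℝ _) u₀.2 := by
      simp only [h2]
      exact (hasFDerivAt_id _).sub_const _
    exact h3.unique h4
  have hinv : (fderiv ℝ P u₀ ∘L .inr ℝ _ _).IsInvertible := by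
    rw [hfd]; exact ⟨ContinuousLinearEquiv.refl ℝ _, rfl⟩
  have hPu : P u₀ = 0 := by rw [h2, sub_self]
  have cdf : ContDiffAt ℝ ∞ P u₀ := hP.contDiffAt
  let ψ := cdf.implicitFunction (by simp) hinv
  have hψ : ContDiffAt ℝ ∞ ψ (0, y₀) := cdf.contDiffAt_implicitFunction (by simp) hinv
  have hψ0 : ψ (0, y₀) = ContinuousMap.const _ y₀ := cdf.implicitFunction_apply_self (by simp) hinv
  have hev := cdf.eventually_apply_implicitFunction (by simp) hinv
  -- The implicit solution is continuous in the sup norm and is constantly y₀ at the base point, so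
  -- nearby solutions stay where χ = 1.
  have hmaps : ∀ᶠ q in 𝓝 ((0 : V), y₀), Set.MapsTo (ψ q) Set.univ (Metric.ball y₀ (r / 3)) := by
    refine hψ.continuousAt.eventually_mem
      ((ContinuousMap.isOpen_setOfPred_mapsTo isCompact_univ Metric.isOpen_ball).mem_nhds ?_)
    rw [hψ0]
    exact fun t _ => Metric.mem_ball_self (by positivity)
  refine ⟨fun q => ψ q ⟨1, by norm_num⟩, ?_, ?_⟩
  · exact (ContinuousMap.evalCLM ℝ (⟨1, by norm_num⟩ : Set.Icc (-2 : ℝ) 2)).contDiff.contDiffAt.comp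
      _ hψ
  · filter_upwards [hev, hmaps] with q hq hm
    have hq' : ∀ t : Set.Icc (-2 : ℝ) 2, ψ q t = q.2 + ∫ s in (0 : ℝ)..t,
        B (X' (ψ q (Set.projIcc (-2) 2 (by norm_num) s))) q.1 := by
      intro t
      have := DFunLike.congr_fun (hq.trans hPu) t
      simp only [P, ContinuousMap.sub_apply, ContinuousMap.const_apply, primitiveL_apply,
        ContinuousMap.zero_apply] at this
      rw [sub_sub, sub_eq_zero] at this
      exact this
    have hcont : Continuous fun s : ℝ =>
        B (X' (ψ q (Set.projIcc (-2) 2 (by norm_num) s))) q.1 := by fun_prop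
    refine ⟨fun t => ψ q (Set.projIcc (-2) 2 (by norm_num) t), ?_, ?_, ?_⟩
    · change ψ q _ = _
      rw [hq', Set.projIcc_of_mem _ (show (0 : ℝ) ∈ Set.Icc (-2 : ℝ) 2 by norm_num),
        intervalIntegral.integral_same, add_zero]
    · simp only
      rw [Set.projIcc_of_mem _ (show (1 : ℝ) ∈ Set.Icc (-2 : ℝ) 2 by norm_num)]
    · intro t ht
      have hmt := hm (Set.mem_univ (Set.projIcc (-2) 2 (by norm_num) t))
      refine ⟨hrU (Metric.ball_subset_ball (by linarith) hmt), ?_⟩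
      have h1 : HasDerivAt (fun t => q.2 + ∫ s in (0 : ℝ)..t,
          B (X' (ψ q (Set.projIcc (-2) 2 (by norm_num) s))) q.1)
          (B (X' (ψ q (Set.projIcc (-2) 2 (by norm_num) t))) q.1) t :=
        (hcont.integral_hasStrictDerivAt 0 t).hasDerivAt.const_add _
      have h3 : X' (ψ q (Set.projIcc (-2) 2 (by norm_num) t)) =
          X (ψ q (Set.projIcc (-2) 2 (by norm_num) t)) := by
        change χ _ • X _ = _
        rw [χ.one_of_mem_closedBall (Metric.ball_subset_closedBall hmt), one_smul]
      rw [h3] at h1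
      refine h1.congr_of_eventuallyEq ?_
      filter_upwards [isOpen_Ioo.mem_nhds ht] with s hs
      rw [hq', Set.projIcc_of_mem _ (Set.Ioo_subset_Icc_self hs)]

end LocalFlow

/-! ### Invariance of a closed 2-form under a flow. -/

section Cartan

/-- Infinitesimal invariance of a closed `2`-form under a flow `g`, in a vector space: if
contracting the pullback of `σ` along `(s, y) ↦ g (s, y)` with `∂/∂s` gives `dh` for a fixed
function `h` of `y`, then the pullback of `σ` under `g (s, ·)` has zero derivative in `s`. -/
theorem hasDerivAt_pullback_of_extDeriv_eq_zero {E : Type*} [NormedAddCommGroup E]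
    [NormedSpace ℝ E] {σ : E → E [⋀^Fin 2]→L[ℝ] ℝ} {g : ℝ × E → E} {h : E → ℝ} {y₀ : E}
    (hg : ContDiffAt ℝ ∞ g (0, y₀)) (hσ : ContDiffAt ℝ ∞ σ (g (0, y₀)))
    (hσ' : extDeriv σ (g (0, y₀)) = 0) (hh : ContDiffAt ℝ ∞ h y₀)
    (hc : ∀ᶠ z in 𝓝 ((0 : ℝ), y₀), ∀ c : E,
      σ (g z) ![fderiv ℝ g z (1, 0), fderiv ℝ g z (0, c)] = fderiv ℝ h z.2 c) (a b : E) :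
    HasDerivAt (fun s : ℝ => σ (g (s, y₀)) ![fderiv ℝ g (s, y₀) (0, a), fderiv ℝ g (s, y₀) (0, b)])
      0 0 := by
  let τ : ℝ × E → (ℝ × E) [⋀^Fin 2]→L[ℝ] ℝ := fun z =>
    (σ (g z)).compContinuousLinearMap (fderiv ℝ g z)
  have hτapp : ∀ z v w, τ z ![v, w] = σ (g z) ![fderiv ℝ g z v, fderiv ℝ g z w] := by
    intro z v w
    change σ (g z) _ = _
    congr 1
    ext i; fin_cases i <;> rfl
  have hmin : minSmoothness ℝ 2 ≤ (∞ : WithTop ℕ∞) := by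
    simp only [minSmoothness_of_isRCLikeNormedField]
    exact WithTop.coe_le_coe.2 (le_top : (2 : ℕ∞) ≤ ⊤)
  have hone : (1 : WithTop ℕ∞) + 1 ≤ ∞ := WithTop.coe_le_coe.2 (le_top : (1 + 1 : ℕ∞) ≤ ⊤)
  -- The exterior derivative commutes with pullback, so no Lie derivative is needed.
  have hd : extDeriv τ (0, y₀) = 0 := by
    have := extDeriv_pullback (𝕜 := ℝ) (r := ∞) (hσ.differentiableAt (by simp)) hg hmin
    rw [hσ'] at this
    rw [show extDeriv τ (0, y₀) = _ from this]
    ext v; rfl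
  have hτ : DifferentiableAt ℝ τ (0, y₀) := by
    refine DifferentiableAt.continuousAlternatingMapCompContinuousLinearMap ?_ ?_
    · exact (hσ.differentiableAt (by simp)).comp _ (hg.differentiableAt (by simp))
    · exact (hg.fderiv_right (m := 1) hone).differentiableAt (by simp)
  -- Evaluating dτ on (∂_s, a, b) gives ∂_s τ(a, b) − ∂_a τ(∂_s, b) + ∂_b τ(∂_s, a). The last two
  -- terms are mixed second derivatives of h and cancel.
  have key := congrArg (fun A => A ![((1 : ℝ), (0 : E)), (0, a), (0, b)]) hd
  simp only [extDeriv_apply hτ] at key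
  replace key := (Fin.sum_univ_three _).symm.trans key
  have e0 : (0 : Fin 3).removeNth ![((1 : ℝ), (0 : E)), (0, a), (0, b)] = ![(0, a), (0, b)] := by
    ext i <;> fin_cases i <;> rfl
  have e1 : (1 : Fin 3).removeNth ![((1 : ℝ), (0 : E)), (0, a), (0, b)] = ![(1, 0), (0, b)] := by
    ext i <;> fin_cases i <;> rfl
  have e2 : (2 : Fin 3).removeNth ![((1 : ℝ), (0 : E)), (0, a), (0, b)] = ![(1, 0), (0, a)] := by
    ext i <;> fin_cases i <;> rfl
  rw [e0, e1, e2] at key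
  have hpart : ∀ c d : E, fderiv ℝ (fun z => τ z ![((1 : ℝ), (0 : E)), (0, c)]) (0, y₀) (0, d) =
      fderiv ℝ (fderiv ℝ h) y₀ d c := by
    intro c d
    have h1 : (fun z => τ z ![((1 : ℝ), (0 : E)), (0, c)]) =ᶠ[𝓝 ((0 : ℝ), y₀)]
        fun z => fderiv ℝ h z.2 c := by
      filter_upwards [hc] with z hz
      rw [hτapp, hz c]
    rw [h1.fderiv_eq]
    have h2 : HasFDerivAt (fderiv ℝ h) (fderiv ℝ (fderiv ℝ h) y₀) y₀ :=
      ((hh.fderiv_right (m := 1) hone).differentiableAt (by simp)).hasFDerivAt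
    have h3 := (HasFDerivAt.comp ((0 : ℝ), y₀) (g := fderiv ℝ h) h2 (hasFDerivAt_snd (𝕜 := ℝ))).clm_apply
      (hasFDerivAt_const c ((0 : ℝ), y₀))
    have h4 := h3.fderiv
    simp only [Function.comp_apply] at h4
    rw [h4]
    simp
  have hsymm : fderiv ℝ (fderiv ℝ h) y₀ a b = fderiv ℝ (fderiv ℝ h) y₀ b a :=
    (hh.isSymmSndFDerivAt hmin).eq a b
  have hmain : fderiv ℝ (fun z => τ z ![((0 : ℝ), a), (0, b)]) (0, y₀) (1, 0) = 0 := by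
    have k1 := hpart b a
    have k2 := hpart a b
    simp at key
    linarith
  have hdiff : DifferentiableAt ℝ (fun z => τ z ![((0 : ℝ), a), (0, b)]) (0, y₀) :=
    hτ.continuousAlternatingMap_apply_const _
  have h5 := hdiff.hasFDerivAt.comp_hasDerivAt (0 : ℝ)
    ((hasDerivAt_id (0 : ℝ)).prodMk (hasDerivAt_const (0 : ℝ) y₀))
  rw [hmain] at h5
  simpa only [Function.comp_def, hτapp, id] using h5

end Cartan

local notation "𝔼" n:max => EuclideanSpace ℝ (Fin n)
local notation "𝔻" n:max => StrongDual ℝ (EuclideanSpace ℝ (Fin n))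

/-! ### Linear algebra of 2-forms. -/

section Flat

variable {E : Type*} [NormedAddCommGroup E] [NormedSpace ℝ E]

namespace ContinuousAlternatingMap

theorem pair_add_left {E : Type*} [AddCommGroup E] [Module ℝ E] [TopologicalSpace E]
    (σ : E [⋀^Fin 2]→L[ℝ] ℝ) (a b w : E) :
    σ ![a + b, w] = σ ![a, w] + σ ![b, w] :=
  σ.vecCons_add ![w] a b

theorem pair_smul_left {E : Type*} [AddCommGroup E] [Module ℝ E] [TopologicalSpace E]
    (σ : E [⋀^Fin 2]→L[ℝ] ℝ) (c : ℝ) (a w : E) :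
    σ ![c • a, w] = c * σ ![a, w] :=
  σ.vecCons_smul ![w] c a

theorem pair_swap {E : Type*} [AddCommGroup E] [Module ℝ E] [TopologicalSpace E]
    (σ : E [⋀^Fin 2]→L[ℝ] ℝ) (a b : E) :
    σ ![a, b] = - σ ![b, a] := by
  have h := σ.map_swap ![b, a] (i := 0) (j := 1) (by simp)
  have e : (![b, a] : Fin 2 → E) ∘ Equiv.swap 0 1 = ![a, b] := by
    ext i; fin_cases i <;> rfl
  rw [e] at h
  exact h

theorem pair_add_right {E : Type*} [AddCommGroup E] [Module ℝ E] [TopologicalSpace E]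
    (σ : E [⋀^Fin 2]→L[ℝ] ℝ) (w a b : E) :
    σ ![w, a + b] = σ ![w, a] + σ ![w, b] := by
  rw [σ.pair_swap, pair_add_left, σ.pair_swap a, σ.pair_swap b]; ring

theorem pair_smul_right {E : Type*} [AddCommGroup E] [Module ℝ E] [TopologicalSpace E]
    (σ : E [⋀^Fin 2]→L[ℝ] ℝ) (c : ℝ) (w a : E) :
    σ ![w, c • a] = c * σ ![w, a] := by
  rw [σ.pair_swap, pair_smul_left, σ.pair_swap a]; ring

/-- A continuous alternating `2`-form as a continuous bilinear map. -/
def flat (σ : E [⋀^Fin 2]→L[ℝ] ℝ) : E →L[ℝ] E →L[ℝ] ℝ :=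
  LinearMap.mkContinuous₂
    (LinearMap.mk₂ ℝ (fun v w => σ ![v, w]) (fun a b w => σ.pair_add_left a b w)
      (fun c a w => σ.pair_smul_left c a w) (fun w a b => σ.pair_add_right w a b)
      (fun c w a => σ.pair_smul_right c w a)) ‖σ‖
    (fun v w => by
      have := σ.le_opNorm ![v, w]
      rw [Fin.prod_univ_two] at this
      rw [mul_assoc]
      exact this)

@[simp]
theorem flat_apply (σ : E [⋀^Fin 2]→L[ℝ] ℝ) (v w : E) : σ.flat v w = σ ![v, w] := rfl

theorem contDiff_flat {m : WithTop ℕ∞} :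
    ContDiff ℝ m (flat : E [⋀^Fin 2]→L[ℝ] ℝ → E →L[ℝ] E →L[ℝ] ℝ) := by
  have hL : ∀ σ : E [⋀^Fin 2]→L[ℝ] ℝ, ‖σ.flat‖ ≤ 1 * ‖σ‖ := fun σ => by
    refine ContinuousLinearMap.opNorm_le_bound₂ σ.flat (by positivity) fun v w => ?_
    have := σ.le_opNorm ![v, w]
    rw [Fin.prod_univ_two] at this
    rw [one_mul, mul_assoc]
    exact this
  exact (IsLinearMap.with_bound (⟨fun σ τ => by ext; rfl, fun c σ => by ext; rfl⟩ :
    IsLinearMap ℝ (flat : E [⋀^Fin 2]→L[ℝ] ℝ → E →L[ℝ] E →L[ℝ] ℝ)) 1 hL).contDiff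

end ContinuousAlternatingMap

end Flat

/-! ### Manifold derivatives read between the model spaces. -/

section Derivative

variable {E : Type*} [NormedAddCommGroup E] [NormedSpace ℝ E] {H : Type*} [TopologicalSpace H]
  (I : ModelWithCorners ℝ E H) {M : Type*} [TopologicalSpace M] [ChartedSpace H M]
  {E' : Type*} [NormedAddCommGroup E'] [NormedSpace ℝ E'] {H' : Type*} [TopologicalSpace H']
  (I' : ModelWithCorners ℝ E' H') {M' : Type*} [TopologicalSpace M'] [ChartedSpace H' M']
  {E'' : Type*} [NormedAddCommGroup E''] [NormedSpace ℝ E''] {H'' : Type*} [TopologicalSpace H'']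
  {I'' : ModelWithCorners ℝ E'' H''} {M'' : Type*} [TopologicalSpace M''] [ChartedSpace H'' M'']

/-- The manifold derivative as a map between the model spaces. -/
def mderiv (f : M → M') (x : M) : E →L[ℝ] E' := mfderiv I I' f x

variable {I I'}

theorem HasMFDerivAt.mderiv_eq {f : M → M'} {x : M} {f' : E →L[ℝ] E'}
    (h : HasMFDerivAt I I' f x f') : mderiv I I' f x = f' := h.mfderiv

theorem MDifferentiableAt.hasMFDerivAt_mderiv {f : M → M'} {x : M}
    (h : MDifferentiableAt I I' f x) : HasMFDerivAt I I' f x (mderiv I I' f x : E →L[ℝ] E') := h.hasMFDerivAt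

theorem mderiv_comp {g : M' → M''} {f : M → M'} {x : M} (hg : MDifferentiableAt I' I'' g (f x))
    (hf : MDifferentiableAt I I' f x) :
    mderiv I I'' (fun y => g (f y)) x = (mderiv I' I'' g (f x)).comp (mderiv I I' f x) :=
  mfderiv_comp x hg hf

theorem Filter.EventuallyEq.mderiv_eq {f g : M → M'} {x : M} (h : f =ᶠ[𝓝 x] g) :
    mderiv I I' f x = mderiv I I' g x := by
  by_cases hg : MDifferentiableAt I I' g x
  · exact (hg.hasMFDerivAt.congr_of_eventuallyEq h).mderiv_eq
  · have hf : ¬ MDifferentiableAt I I' f x := fun hf => hg (hf.congr_of_eventuallyEq h.symm)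
    exact (mfderiv_zero_of_not_mdifferentiableAt hf).trans
      (mfderiv_zero_of_not_mdifferentiableAt hg).symm

theorem mderiv_id (x : M) : mderiv I I (fun y : M => y) x = ContinuousLinearMap.id ℝ E :=
  mfderiv_id

theorem mderiv_eq_fderiv {f : E → E'} {x : E} : mderiv 𝓘(ℝ, E) 𝓘(ℝ, E') f x = fderiv ℝ f x :=
  mfderiv_eq_fderiv

end Derivative

section Charts

variable {E : Type*} [NormedAddCommGroup E] [NormedSpace ℝ E]
  {M : Type*} [TopologicalSpace M] [ChartedSpace E M]

theorem OpenPartialHomeomorph.mdifferentiable_of_mem_maximalAtlas {e : OpenPartialHomeomorph M E}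
    (he : e ∈ IsManifold.maximalAtlas 𝓘(ℝ, E) ∞ M) : e.MDifferentiable 𝓘(ℝ, E) 𝓘(ℝ, E) :=
  ⟨(contMDiffOn_of_mem_maximalAtlas he).mdifferentiableOn (by simp),
    (contMDiffOn_symm_of_mem_maximalAtlas he).mdifferentiableOn (by simp)⟩

theorem mderiv_symm_apply_mderiv {e : OpenPartialHomeomorph M E}
    (he : e ∈ IsManifold.maximalAtlas 𝓘(ℝ, E) ∞ M) {x : M} (hx : x ∈ e.source) (v : E) :
    mderiv 𝓘(ℝ, E) 𝓘(ℝ, E) e.symm (e x) (mderiv 𝓘(ℝ, E) 𝓘(ℝ, E) e x v) = v :=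
  congrArg (fun A : E →L[ℝ] E => A v)
    ((OpenPartialHomeomorph.mdifferentiable_of_mem_maximalAtlas he).symm_comp_deriv hx)

theorem mderiv_apply_mderiv_symm {e : OpenPartialHomeomorph M E}
    (he : e ∈ IsManifold.maximalAtlas 𝓘(ℝ, E) ∞ M) {y : E} (hy : y ∈ e.target) (v : E) :
    mderiv 𝓘(ℝ, E) 𝓘(ℝ, E) e (e.symm y) (mderiv 𝓘(ℝ, E) 𝓘(ℝ, E) e.symm y v) = v :=
  congrArg (fun A : E →L[ℝ] E => A v)
    ((OpenPartialHomeomorph.mdifferentiable_of_mem_maximalAtlas he).comp_symm_deriv hy)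

end Charts

/-! ### Local sections and the vertical fields X_β. -/

namespace LagrangianFibration

variable {n : ℕ} {B : Opens (𝔼 n)}
  {E : Type*} [NormedAddCommGroup E] [NormedSpace ℝ E]
  {M : Type*} [TopologicalSpace M] [ChartedSpace E M]

/-- The projection of a Lagrangian fibration, as a map to `ℝⁿ`. -/
def base (F : LagrangianFibration B E M) (x : M) : 𝔼 n := F.proj x

theorem contMDiff_base (F : LagrangianFibration B E M) :
    ContMDiff 𝓘(ℝ, E) 𝓘(ℝ, 𝔼 n) ∞ F.base :=
  contMDiff_subtype_val.comp F.submersion.contMDiff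

/-- The differential of the projection. -/
def dbase (F : LagrangianFibration B E M) (x : M) : E →L[ℝ] 𝔼 n :=
  mderiv 𝓘(ℝ, E) 𝓘(ℝ, 𝔼 n) F.base x

/-- The symplectic form at a point, as an alternating form on the model space. -/
def form (F : LagrangianFibration B E M) (x : M) : E [⋀^Fin 2]→L[ℝ] ℝ :=
  F.symplecticForm.toForm x

theorem mdifferentiableAt_base (F : LagrangianFibration B E M) (x : M) :
    MDifferentiableAt 𝓘(ℝ, E) 𝓘(ℝ, 𝔼 n) F.base x :=
  F.contMDiff_base.mdifferentiable (by simp) x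

theorem mfderiv_proj (F : LagrangianFibration B E M) (x : M) :
    mfderiv 𝓘(ℝ, E) 𝓘(ℝ, 𝔼 n) F.proj x = F.dbase x := by
  have h2 : MDifferentiableAt 𝓘(ℝ, E) 𝓘(ℝ, 𝔼 n) F.proj x :=
    F.submersion.contMDiff.mdifferentiable (by simp) x
  exact (if_pos h2).trans (if_pos (F.mdifferentiableAt_base x)).symm

/-- Through every point there passes a smooth local section. -/
theorem exists_section [IsManifold 𝓘(ℝ, E) ∞ M] (F : LagrangianFibration B E M) (x : M) :
    ∃ s : 𝔼 n → M, ContMDiffAt 𝓘(ℝ, 𝔼 n) 𝓘(ℝ, E) ∞ s (F.base x) ∧ s (F.base x) = x ∧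
      ∀ᶠ b in 𝓝 (F.base x), F.base (s b) = b := by
  have hS := F.submersion.isSubmersionAt x
  let φ := hS.domChart
  let ψ := hS.codChart
  -- In submersion charts the projection forgets the second coordinate; the section freezes that
  -- coordinate at its value for x.
  let τ : B → M := fun b => φ.symm (hS.equiv.symm (ψ b, (hS.equiv (φ x)).2))
  have hmem : ∀ {y}, y ∈ φ.target → y ∈ (φ.extend 𝓘(ℝ, E)).target := fun {y} hy => by
    rw [OpenPartialHomeomorph.extend_target_eq_image_source, ← φ.right_inv hy]
    exact ⟨φ.symm y, φ.map_target hy, rfl⟩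
  have hψ0 : (hS.equiv (φ x)).1 = ψ (F.proj x) := by
    have h := hS.writtenInCharts (hmem (φ.map_source hS.mem_domChart_source))
    simp only [Function.comp_apply, OpenPartialHomeomorph.extend_coe,
      OpenPartialHomeomorph.extend_coe_symm, modelWithCornersSelf_coe,
      modelWithCornersSelf_coe_symm, id] at h
    rw [← h]
    change ψ (F.proj (φ.symm (φ x))) = _
    rw [φ.left_inv hS.mem_domChart_source]
  have h0 : hS.equiv.symm (ψ (F.proj x), (hS.equiv (φ x)).2) = φ x := by
    rw [← hψ0]; simp
  have hτ0 : τ (F.proj x) = x := by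
    change φ.symm _ = x
    rw [h0, φ.left_inv hS.mem_domChart_source]
  have hin : ContMDiffAt 𝓘(ℝ, 𝔼 n) 𝓘(ℝ, E) ∞
      (fun b : B => hS.equiv.symm (ψ b, (hS.equiv (φ x)).2)) (F.proj x) := by
    have h1 : ContMDiffAt 𝓘(ℝ, 𝔼 n) 𝓘(ℝ, 𝔼 n) ∞ ψ (F.proj x) :=
      contMDiffAt_of_mem_maximalAtlas hS.codChart_mem_maximalAtlas hS.mem_codChart_source
    have h2 : ContDiff ℝ ∞ fun b : 𝔼 n => hS.equiv.symm (b, (hS.equiv (φ x)).2) :=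
      hS.equiv.symm.contDiff.comp (contDiff_id.prodMk contDiff_const)
    exact h2.contMDiff.contMDiffAt.comp _ h1
  have hτ : ContMDiffAt 𝓘(ℝ, 𝔼 n) 𝓘(ℝ, E) ∞ τ (F.proj x) := by
    refine ContMDiffAt.comp (F.proj x) ?_ hin
    rw [h0]
    exact contMDiffAt_symm_of_mem_maximalAtlas hS.domChart_mem_maximalAtlas
      (φ.map_source hS.mem_domChart_source)
  have hτs : ∀ᶠ b in 𝓝 (F.proj x), F.proj (τ b) = b := by
    have h1 : ∀ᶠ b in 𝓝 (F.proj x), hS.equiv.symm (ψ b, (hS.equiv (φ x)).2) ∈ φ.target := by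
      refine hin.continuousAt.eventually_mem (φ.open_target.mem_nhds ?_)
      rw [h0]
      exact φ.map_source hS.mem_domChart_source
    filter_upwards [h1, ψ.open_source.mem_nhds hS.mem_codChart_source] with b hb hb'
    have h := hS.writtenInCharts (hmem hb)
    simp only [Function.comp_apply, OpenPartialHomeomorph.extend_coe,
      OpenPartialHomeomorph.extend_coe_symm, modelWithCornersSelf_coe,
      modelWithCornersSelf_coe_symm, id, ContinuousLinearEquiv.apply_symm_apply] at h
    refine ψ.injOn ?_ hb' h
    exact hS.source_subset_preimage_source (φ.map_target hb)
  classical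
  -- The value off B is irrelevant, since B is a neighbourhood of the base point.
  let s : 𝔼 n → M := fun b => if hb : b ∈ B then τ ⟨b, hb⟩ else x
  have hsτ : ∀ b : B, s b = τ b := fun b => dif_pos b.2
  refine ⟨s, ?_, (hsτ (F.proj x)).trans hτ0, ?_⟩
  · refine (contMDiffAt_subtype_iff (U := B) (x := F.proj x)).1 ?_
    simpa only [hsτ] using hτ
  · have h3 : Filter.map (Subtype.val : B → 𝔼 n) (𝓝 (F.proj x)) = 𝓝 (F.base x) :=
      B.2.isOpenEmbedding_subtypeVal.map_nhds_eq (F.proj x)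
    rw [← h3, Filter.eventually_map]
    filter_upwards [hτs] with b hb
    rw [hsτ, base, hb]

/-- Differentiate π ∘ s = id for a local section s. -/
theorem surjective_dbase [IsManifold 𝓘(ℝ, E) ∞ M] (F : LagrangianFibration B E M) (x : M) :
    Function.Surjective (F.dbase x) := by
  obtain ⟨s, hs, hsx, hb⟩ := F.exists_section x
  intro w
  have h2 := mderiv_comp (F.mdifferentiableAt_base (s (F.base x))) (hs.mdifferentiableAt (by simp))
  rw [Filter.EventuallyEq.mderiv_eq (g := fun b => b) hb, mderiv_id, hsx] at h2
  exact ⟨_, (congrArg (fun A : 𝔼 n →L[ℝ] 𝔼 n => A w) h2).symm⟩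

theorem eq_zero_of_form_eq_zero (F : LagrangianFibration B E M) {x : M} {v : E}
    (h : ∀ w, F.form x ![v, w] = 0) : v = 0 :=
  F.symplecticForm.nondegenerate x v h

theorem dbase_eq_zero_iff (F : LagrangianFibration B E M) (x : M) (v : E) :
    F.dbase x v = 0 ↔ ∀ w, F.dbase x w = 0 → F.form x ![v, w] = 0 := by
  have h := F.lagrangian_fibres x v
  rw [mfderiv_proj] at h
  exact h

theorem twoFormInChart_apply (F : LagrangianFibration B E M)
    (e : OpenPartialHomeomorph M E) (y v w : E) :
    twoFormInChart F.symplecticForm.toForm e y ![v, w] = F.form (e.symm y)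
      ![mderiv 𝓘(ℝ, E) 𝓘(ℝ, E) e.symm y v, mderiv 𝓘(ℝ, E) 𝓘(ℝ, E) e.symm y w] := by
  change F.form (e.symm y) _ = _
  congr 1
  ext i; fin_cases i <;> rfl

theorem contDiffOn_base_symm (F : LagrangianFibration B E M) {e : OpenPartialHomeomorph M E}
    (he : e ∈ IsManifold.maximalAtlas 𝓘(ℝ, E) ∞ M) :
    ContDiffOn ℝ ∞ (fun z => F.base (e.symm z)) e.target :=
  (F.contMDiff_base.comp_contMDiffOn (contMDiffOn_symm_of_mem_maximalAtlas he)).contDiffOn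

theorem fderiv_base_symm (F : LagrangianFibration B E M) {e : OpenPartialHomeomorph M E}
    (he : e ∈ IsManifold.maximalAtlas 𝓘(ℝ, E) ∞ M) {y : E} (hy : y ∈ e.target) (w : E) :
    fderiv ℝ (fun z => F.base (e.symm z)) y w =
      F.dbase (e.symm y) (mderiv 𝓘(ℝ, E) 𝓘(ℝ, E) e.symm y w) := by
  rw [← mderiv_eq_fderiv, mderiv_comp (F.mdifferentiableAt_base _)
    ((OpenPartialHomeomorph.mdifferentiable_of_mem_maximalAtlas he).mdifferentiableAt_symm hy)]
  rfl

section HamVec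

variable [FiniteDimensional ℝ E]

/-- The vector field `X_β` of a constant covector `β`, defined by `ω(X_β, ·) = β ∘ dπ`. -/
def hamVec (F : LagrangianFibration B E M) (β : 𝔻 n) (x : M) : E :=
  (F.existsUnique_vector β x).choose

theorem form_hamVec (F : LagrangianFibration B E M) (β : 𝔻 n) (x : M) (v : E) :
    F.form x ![F.hamVec β x, v] = β (F.dbase x v) := by
  exact ((F.existsUnique_vector β x).choose_spec.1 v).trans
    (congrArg (fun A : E →L[ℝ] 𝔼 n => β (A v)) (F.mfderiv_proj x))

theorem eq_hamVec (F : LagrangianFibration B E M) {β : 𝔻 n} {x : M} {X : E}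
    (h : ∀ v, F.form x ![X, v] = β (F.dbase x v)) : X = F.hamVec β x := by
  exact (F.existsUnique_vector β x).choose_spec.2 X fun v => (h v).trans
    (congrArg (fun A : E →L[ℝ] 𝔼 n => β (A v)) (F.mfderiv_proj x)).symm

theorem hamVec_add (F : LagrangianFibration B E M) (β γ : 𝔻 n) (x : M) :
    F.hamVec (β + γ) x = F.hamVec β x + F.hamVec γ x :=
  (F.eq_hamVec fun v => by
    rw [ContinuousAlternatingMap.pair_add_left, form_hamVec, form_hamVec]; rfl).symm

theorem hamVec_smul (F : LagrangianFibration B E M) (c : ℝ) (β : 𝔻 n) (x : M) :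
    F.hamVec (c • β) x = c • F.hamVec β x :=
  (F.eq_hamVec fun v => by
    rw [ContinuousAlternatingMap.pair_smul_left, form_hamVec]; rfl).symm

/-- The form ω(X_β, ·) = β ∘ dπ kills ker dπ, and ker dπ is its own ω-orthogonal. -/
theorem dbase_hamVec (F : LagrangianFibration B E M) (β : 𝔻 n) (x : M) :
    F.dbase x (F.hamVec β x) = 0 :=
  (F.dbase_eq_zero_iff x _).2 fun w hw => by rw [form_hamVec, hw, map_zero]

theorem form_hamVec_hamVec (F : LagrangianFibration B E M) (β γ : 𝔻 n) (x : M) :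
    F.form x ![F.hamVec β x, F.hamVec γ x] = 0 := by
  rw [form_hamVec, dbase_hamVec, map_zero]

theorem eq_zero_of_hamVec_eq_zero [IsManifold 𝓘(ℝ, E) ∞ M] (F : LagrangianFibration B E M)
    {β : 𝔻 n} {x : M} (h : F.hamVec β x = 0) : β = 0 := by
  ext w
  obtain ⟨v, rfl⟩ := F.surjective_dbase x w
  rw [← F.form_hamVec, h, ← zero_smul ℝ (0 : E), ContinuousAlternatingMap.pair_smul_left, zero_mul]
  rfl

/-- For vertical v the form ω(v, ·) vanishes on ker dπ, so it factors through dπ; a linear right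
inverse of dπ reads off the factor. -/
theorem exists_hamVec_eq [IsManifold 𝓘(ℝ, E) ∞ M] (F : LagrangianFibration B E M) {x : M} {v : E}
    (hv : F.dbase x v = 0) : ∃ β : 𝔻 n, F.hamVec β x = v := by
  obtain ⟨r, hr⟩ := (F.dbase x).toLinearMap.exists_rightInverse_of_surjective
    (LinearMap.range_eq_top.2 (F.surjective_dbase x))
  have hr' : ∀ w, F.dbase x (r w) = w := fun w => LinearMap.congr_fun hr w
  let β : 𝔻 n := LinearMap.toContinuousLinearMap (((F.form x).flat v).toLinearMap ∘ₗ r)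
  refine ⟨β, (F.eq_hamVec fun w => ?_).symm⟩
  have h0 := (F.dbase_eq_zero_iff x v).1 hv (w - r (F.dbase x w))
    (by rw [map_sub, hr', sub_self])
  have h1 : (F.form x).flat v (w - r (F.dbase x w)) = 0 := h0
  rw [map_sub, sub_eq_zero] at h1
  exact h1

/-- The linear map `β ↦ X_β` in a chart. -/
def hamChart (F : LagrangianFibration B E M) (e : OpenPartialHomeomorph M E) (y : E) :
    𝔻 n →L[ℝ] E :=
  (twoFormInChart F.symplecticForm.toForm e y).flat.inverse ∘L
    (ContinuousLinearMap.compL ℝ E (𝔼 n) ℝ).flip (fderiv ℝ (fun z => F.base (e.symm z)) y)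

theorem isInvertible_flat_twoFormInChart (F : LagrangianFibration B E M) {e : OpenPartialHomeomorph M E}
    (he : e ∈ IsManifold.maximalAtlas 𝓘(ℝ, E) ∞ M) {y : E} (hy : y ∈ e.target) :
    (twoFormInChart F.symplecticForm.toForm e y).flat.IsInvertible := by
  have hinj : Function.Injective (twoFormInChart F.symplecticForm.toForm e y).flat := by
    rw [injective_iff_map_eq_zero]
    intro v hv
    have h1 : mderiv 𝓘(ℝ, E) 𝓘(ℝ, E) e.symm y v = 0 := by
      refine F.eq_zero_of_form_eq_zero (x := e.symm y) fun w => ?_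
      have h2 : (twoFormInChart F.symplecticForm.toForm e y).flat v
          (mderiv 𝓘(ℝ, E) 𝓘(ℝ, E) e (e.symm y) w) = 0 :=
        congrArg (fun A : E →L[ℝ] ℝ => A _) hv
      have h3 := mderiv_symm_apply_mderiv he (e.map_target hy) w
      rw [e.right_inv hy] at h3
      simpa only [ContinuousAlternatingMap.flat_apply, twoFormInChart_apply, h3] using h2
    rw [← mderiv_apply_mderiv_symm he hy v, h1, map_zero]
  have hfin : Module.finrank ℝ E = Module.finrank ℝ (E →L[ℝ] ℝ) := by
    rw [← (LinearMap.toContinuousLinearMap (𝕜 := ℝ) (E := E) (F' := ℝ)).finrank_eq]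
    exact (Subspace.dual_finrank_eq (K := ℝ) (V := E)).symm
  exact ⟨(LinearEquiv.ofInjectiveOfFinrankEq _ hinj hfin).toContinuousLinearEquiv, by ext; rfl⟩

/-- The chart expression inverts a smooth family of invertible operators, and operator inversion is
smooth. -/
theorem contDiffOn_hamChart (F : LagrangianFibration B E M) {e : OpenPartialHomeomorph M E}
    (he : e ∈ IsManifold.maximalAtlas 𝓘(ℝ, E) ∞ M) : ContDiffOn ℝ ∞ (F.hamChart e) e.target := by
  intro y hy
  refine ContDiffAt.contDiffWithinAt ?_
  have h1 : ContDiffAt ℝ ∞ (twoFormInChart F.symplecticForm.toForm e) y :=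
    (F.symplecticForm.smooth e he).contDiffAt (e.open_target.mem_nhds hy)
  have h2 : ContDiffAt ℝ ∞ (fderiv ℝ (fun z => F.base (e.symm z))) y :=
    ((F.contDiffOn_base_symm he).contDiffAt (e.open_target.mem_nhds hy)).fderiv_right
      (by simp)
  have h3 : ContDiffAt ℝ ∞ (fun y => (twoFormInChart F.symplecticForm.toForm e y).flat) y :=
    ContinuousAlternatingMap.contDiff_flat.contDiffAt.comp y h1
  have h4 := (F.isInvertible_flat_twoFormInChart he hy).contDiffAt_map_inverse (n := ∞)
  exact (h4.comp y h3).clm_comp (((ContinuousLinearMap.compL ℝ E (𝔼 n) ℝ).flip).contDiff.contDiffAt.comp y h2)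

theorem mderiv_symm_hamChart (F : LagrangianFibration B E M) {e : OpenPartialHomeomorph M E}
    (he : e ∈ IsManifold.maximalAtlas 𝓘(ℝ, E) ∞ M) {y : E} (hy : y ∈ e.target) (β : 𝔻 n) :
    mderiv 𝓘(ℝ, E) 𝓘(ℝ, E) e.symm y (F.hamChart e y β) = F.hamVec β (e.symm y) := by
  refine F.eq_hamVec fun v => ?_
  have h3 := mderiv_symm_apply_mderiv he (e.map_target hy) v
  rw [e.right_inv hy] at h3
  rw [← h3, ← F.fderiv_base_symm he hy, ← F.twoFormInChart_apply, ← ContinuousAlternatingMap.flat_apply]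
  have h4 := (F.isInvertible_flat_twoFormInChart he hy).self_apply_inverse
    (β ∘L (fderiv ℝ (fun z => F.base (e.symm z)) y))
  exact congrArg (fun A : E →L[ℝ] ℝ => A _) h4

theorem hamChart_apply (F : LagrangianFibration B E M) {e : OpenPartialHomeomorph M E}
    (he : e ∈ IsManifold.maximalAtlas 𝓘(ℝ, E) ∞ M) {x : M} (hx : x ∈ e.source) (β : 𝔻 n) :
    F.hamChart e (e x) β = mderiv 𝓘(ℝ, E) 𝓘(ℝ, E) e x (F.hamVec β x) := by
  have h := F.mderiv_symm_hamChart he (e.map_source hx) β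
  have h2 := mderiv_apply_mderiv_symm he (e.map_source hx) (F.hamChart e (e x) β)
  rw [h, e.left_inv hx] at h2
  exact h2.symm

/-- The field is the pullback of `hamChart` under a chart. Class C¹ is what uniqueness of integral
curves uses. -/
theorem contMDiff_hamVec [IsManifold 𝓘(ℝ, E) ∞ M] (F : LagrangianFibration B E M) (β : 𝔻 n) :
    ContMDiff 𝓘(ℝ, E) 𝓘(ℝ, E).tangent 1
      (fun x => (⟨x, F.hamVec β x⟩ : TangentBundle 𝓘(ℝ, E) M)) := by
  have : CompleteSpace E := FiniteDimensional.complete ℝ E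
  intro x
  let e := chartAt E x
  have he : e ∈ IsManifold.maximalAtlas 𝓘(ℝ, E) ∞ M := IsManifold.chart_mem_maximalAtlas x
  have hx : x ∈ e.source := mem_chart_source E x
  let W : ∀ y : E, TangentSpace 𝓘(ℝ, E) y := fun y => F.hamChart e y β
  have hW : ContMDiffAt 𝓘(ℝ, E) 𝓘(ℝ, E).tangent 1
      (fun y => (⟨y, W y⟩ : TangentBundle 𝓘(ℝ, E) E)) (e x) := by
    refine contMDiffAt_vectorSpace_iff_contDiffAt.2 ?_
    exact (((F.contDiffOn_hamChart he).contDiffAt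
      (e.open_target.mem_nhds (e.map_source hx))).clm_apply contDiffAt_const).of_le (by simp)
  have hd := OpenPartialHomeomorph.mdifferentiable_of_mem_maximalAtlas he
  have h := ContMDiffAt.mpullback_vectorField_preimage (n := ∞) (m := 1) hW
    (contMDiffAt_of_mem_maximalAtlas he hx) ⟨hd.mfderiv hx, rfl⟩
    (WithTop.coe_le_coe.2 (le_top : (1 + 1 : ℕ∞) ≤ ⊤))
  refine h.congr_of_eventuallyEq ?_
  filter_upwards [e.open_source.mem_nhds hx] with z hz
  have h3 := F.hamChart_apply he hz β
  have h4 : VectorField.mpullback 𝓘(ℝ, E) 𝓘(ℝ, E) e W z = F.hamVec β z := by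
    have h5 : (mfderiv 𝓘(ℝ, E) 𝓘(ℝ, E) e z).inverse = ((hd.mfderiv hz).symm : _ →L[ℝ] _) :=
      ContinuousLinearMap.inverse_equiv (hd.mfderiv hz)
    have h6 : W (e z) = hd.mfderiv hz (F.hamVec β z) := h3
    rw [VectorField.mpullback_apply, h5, h6]
    exact (hd.mfderiv hz).symm_apply_apply _
  rw [h4]

end HamVec

end LagrangianFibration

/-! ### Integral curves and time-one maps. -/

section Velocity

variable {E : Type*} [NormedAddCommGroup E] [NormedSpace ℝ E] {H : Type*} [TopologicalSpace H]
  (I : ModelWithCorners ℝ E H) {M : Type*} [TopologicalSpace M] [ChartedSpace H M]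
  {E' : Type*} [NormedAddCommGroup E'] [NormedSpace ℝ E'] {H' : Type*} [TopologicalSpace H']
  {I' : ModelWithCorners ℝ E' H'} {M' : Type*} [TopologicalSpace M'] [ChartedSpace H' M']

/-- The curve `γ` has velocity `v` at time `t`. -/
def HasVelocityAt (γ : ℝ → M) (v : E) (t : ℝ) : Prop :=
  HasMFDerivAt 𝓘(ℝ, ℝ) I γ t ((1 : ℝ →L[ℝ] ℝ).smulRight v : ℝ →L[ℝ] E)

variable {I}

theorem HasVelocityAt.comp {γ : ℝ → M} {v : E} {t : ℝ} {f : M → M'}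
    (hf : MDifferentiableAt I I' f (γ t)) (h : HasVelocityAt I γ v t) :
    HasVelocityAt I' (fun t => f (γ t)) (mderiv I I' f (γ t) v) t := by
  have h1 := HasMFDerivAt.comp t hf.hasMFDerivAt_mderiv h
  have h2 : (mderiv I I' f (γ t)).comp ((1 : ℝ →L[ℝ] ℝ).smulRight v) =
      (1 : ℝ →L[ℝ] ℝ).smulRight (mderiv I I' f (γ t) v) := by
    ext; simp
  unfold HasVelocityAt
  rw [← h2]
  exact h1

theorem hasVelocityAt_iff_hasDerivAt {γ : ℝ → E} {v : E} {t : ℝ} :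
    HasVelocityAt 𝓘(ℝ, E) γ v t ↔ HasDerivAt γ v t := by
  have h : ((1 : ℝ →L[ℝ] ℝ).smulRight v : ℝ →L[ℝ] E) = ContinuousLinearMap.toSpanSingleton ℝ v := by
    ext; simp
  unfold HasVelocityAt
  rw [h]
  exact hasMFDerivAt_iff_hasFDerivAt

theorem HasVelocityAt.unique {γ : ℝ → M} {v w : E} {t : ℝ} (h : HasVelocityAt I γ v t)
    (h' : HasVelocityAt I γ w t) : v = w := by
  have h1 := hasMFDerivAt_unique h h'
  have h2 := congrArg (fun A : ℝ →L[ℝ] E => A 1) h1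
  simpa using h2

theorem HasVelocityAt.mdifferentiableAt {γ : ℝ → M} {v : E} {t : ℝ} (h : HasVelocityAt I γ v t) :
    MDifferentiableAt 𝓘(ℝ, ℝ) I γ t := HasMFDerivAt.mdifferentiableAt h

theorem HasVelocityAt.congr {γ γ' : ℝ → M} {v : E} {t : ℝ} (h : HasVelocityAt I γ v t)
    (h' : γ' =ᶠ[𝓝 t] γ) : HasVelocityAt I γ' v t :=
  HasMFDerivAt.congr_of_eventuallyEq h h'

end Velocity

namespace LagrangianFibration

variable {n : ℕ} {B : Opens (𝔼 n)}
  {E : Type*} [NormedAddCommGroup E] [NormedSpace ℝ E]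
  {M : Type*} [TopologicalSpace M] [ChartedSpace E M] [FiniteDimensional ℝ E]

theorem exists_compactOneForm (b : B) (β : 𝔻 n) : ∃ α : CompactOneForm B, α.toFun b = β := by
  have : T2Space B := inferInstance
  obtain ⟨f⟩ : Nonempty (SmoothBumpFunction 𝓘(ℝ, 𝔼 n) b) := inferInstance
  refine ⟨⟨fun x => f x • β, ?_, ?_⟩, ?_⟩
  · exact f.contMDiff.smul contMDiff_const
  · exact f.hasCompactSupport.smul_right
  · simp

/-- The velocity is vertical. The covector may depend on time so that the lemma covers α(π(γ t))
before that covector is known to be constant. -/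
theorem base_eq_of_hasVelocityAt {F : LagrangianFibration B E M} {γ : ℝ → M} {β : ℝ → 𝔻 n}
    (hγ : ∀ t, HasVelocityAt 𝓘(ℝ, E) γ (F.hamVec (β t) (γ t)) t) (t : ℝ) :
    F.base (γ t) = F.base (γ 0) := by
  have hd : ∀ t, HasDerivAt (fun t => F.base (γ t)) 0 t := by
    intro t
    have h1 := (hγ t).comp (F.mdifferentiableAt_base (γ t))
    have h2 : mderiv 𝓘(ℝ, E) 𝓘(ℝ, 𝔼 n) F.base (γ t) (F.hamVec (β t) (γ t)) = 0 :=
      F.dbase_hamVec _ _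
    rw [h2] at h1
    exact hasVelocityAt_iff_hasDerivAt.1 h1
  exact is_const_of_deriv_eq_zero (fun t => (hd t).differentiableAt) (fun t => (hd t).deriv) t 0

theorem isMIntegralCurve_hamVec_of_vectorField {F : LagrangianFibration B E M} {γ : ℝ → M}
    {α : CompactOneForm B} (hγ : IsMIntegralCurve (I := 𝓘(ℝ, E)) γ (F.vectorField α)) (t : ℝ) :
    HasVelocityAt 𝓘(ℝ, E) γ (F.hamVec (α.toFun (F.proj (γ 0))) (γ t)) t := by
  have h1 : ∀ t, HasVelocityAt 𝓘(ℝ, E) γ (F.hamVec (α.toFun (F.proj (γ t))) (γ t)) t := hγ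
  have h2 : F.proj (γ t) = F.proj (γ 0) := Subtype.ext (base_eq_of_hasVelocityAt h1 t)
  have h3 := h1 t
  rwa [h2] at h3

/-- An integral curve stays in one fibre, where X_{π^*α} depends only on the value of α. A compactly
supported α with the prescribed value therefore supplies the curve. -/
theorem exists_integralCurve (F : LagrangianFibration B E M) (hF : F.IsComplete) (β : 𝔻 n)
    (x : M) : ∃ γ : ℝ → M, γ 0 = x ∧ ∀ t, HasVelocityAt 𝓘(ℝ, E) γ (F.hamVec β (γ t)) t := by
  obtain ⟨α, rfl⟩ := exists_compactOneForm (F.proj x) β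
  obtain ⟨γ, rfl, hγ⟩ := hF α x
  exact ⟨γ, rfl, isMIntegralCurve_hamVec_of_vectorField hγ⟩

/-- The time-one map of the vector field `X_β` of a constant covector. -/
def timeOne (F : LagrangianFibration B E M) (hF : F.IsComplete) (β : 𝔻 n) (x : M) : M :=
  (F.exists_integralCurve hF β x).choose 1

theorem base_timeOne {F : LagrangianFibration B E M} (hF : F.IsComplete)
    (β : 𝔻 n) (x : M) : F.base (F.timeOne hF β x) = F.base x := by
  obtain ⟨h0, h1⟩ := (F.exists_integralCurve hF β x).choose_spec
  have h2 := base_eq_of_hasVelocityAt (β := fun _ => β) h1 1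
  rw [h0] at h2
  exact h2

section Unique

variable [T2Space M] [IsManifold 𝓘(ℝ, E) ∞ M] {F : LagrangianFibration B E M}

theorem eqOn_of_hasVelocityAt {β : 𝔻 n} {γ γ' : ℝ → M} {a b t₀ : ℝ} (ht₀ : t₀ ∈ Set.Ioo a b)
    (hγ : ∀ t ∈ Set.Ioo a b, HasVelocityAt 𝓘(ℝ, E) γ (F.hamVec β (γ t)) t)
    (hγ' : ∀ t ∈ Set.Ioo a b, HasVelocityAt 𝓘(ℝ, E) γ' (F.hamVec β (γ' t)) t)
    (h : γ t₀ = γ' t₀) : Set.EqOn γ γ' (Set.Ioo a b) := by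
  have : CompleteSpace E := FiniteDimensional.complete ℝ E
  have : IsManifold 𝓘(ℝ, E) 1 M := IsManifold.of_le (n := ∞) (by simp)
  exact isMIntegralCurveOn_Ioo_eqOn_of_contMDiff_boundaryless ht₀ (F.contMDiff_hamVec β)
    (fun t ht => HasMFDerivAt.hasMFDerivWithinAt (hγ t ht))
    (fun t ht => HasMFDerivAt.hasMFDerivWithinAt (hγ' t ht)) h

variable (hF : F.IsComplete)

/-- Assuming the equation only on (-2, 2) lets this apply to the local flows built in charts. -/
theorem eq_timeOne {β : 𝔻 n} {γ : ℝ → M}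
    (hγ : ∀ t ∈ Set.Ioo (-2 : ℝ) 2, HasVelocityAt 𝓘(ℝ, E) γ (F.hamVec β (γ t)) t) :
    γ 1 = F.timeOne hF β (γ 0) := by
  have h := (F.exists_integralCurve hF β (γ 0)).choose_spec
  exact eqOn_of_hasVelocityAt (t₀ := 0) (by norm_num) hγ (fun t _ => h.2 t) h.1.symm
    (show (1 : ℝ) ∈ Set.Ioo (-2 : ℝ) 2 by norm_num)

/-- Rescaling time by s turns curves of X_β into curves of X_{sβ}. The time-one maps thus contain
the whole flow. -/
theorem eq_timeOne_smul {β : 𝔻 n} {γ : ℝ → M}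
    (hγ : ∀ t, HasVelocityAt 𝓘(ℝ, E) γ (F.hamVec β (γ t)) t) (s : ℝ) :
    γ s = F.timeOne hF (s • β) (γ 0) := by
  have h1 : ∀ t, HasVelocityAt 𝓘(ℝ, E) (γ ∘ (· * s)) (F.hamVec (s • β) (γ (t * s))) t := by
    intro t
    have h2 : IsMIntegralCurve (I := 𝓘(ℝ, E)) γ (F.hamVec β) := hγ
    have h3 := h2.comp_mul s t
    rw [hamVec_smul]
    exact h3
  have h4 := eq_timeOne hF fun t _ => h1 t
  simpa using h4

theorem hasVelocityAt_timeOne (β : 𝔻 n) (x : M) (t : ℝ) :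
    HasVelocityAt 𝓘(ℝ, E) (fun t : ℝ => F.timeOne hF (t • β) x)
      (F.hamVec β (F.timeOne hF (t • β) x)) t := by
  obtain ⟨h0, h1⟩ := (F.exists_integralCurve hF β x).choose_spec
  have h2 := eq_timeOne_smul hF h1
  rw [h0] at h2
  have h3 := h1 t
  rw [h2 t] at h3
  exact h3.congr (Filter.Eventually.of_forall fun s => (h2 s).symm)

theorem timeOne_zero (x : M) : F.timeOne hF 0 x = x := by
  obtain ⟨h0, h1⟩ := (F.exists_integralCurve hF 0 x).choose_spec
  have h2 := eq_timeOne_smul hF h1 0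
  rw [h0, zero_smul] at h2
  exact h2.symm

theorem timeOne_add_smul (β : 𝔻 n) (s t : ℝ) (x : M) :
    F.timeOne hF ((s + t) • β) x = F.timeOne hF (s • β) (F.timeOne hF (t • β) x) := by
  have h1 : IsMIntegralCurve (I := 𝓘(ℝ, E)) (fun t : ℝ => F.timeOne hF (t • β) x) (F.hamVec β) :=
    hasVelocityAt_timeOne hF β x
  have h2 := eq_timeOne_smul hF (h1.comp_add t) s
  simpa using h2

theorem flow_one (α : CompactOneForm B) (x : M) :
    F.flow hF α 1 x = F.timeOne hF (α.toFun (F.proj x)) x := by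
  obtain ⟨h0, h1⟩ := (hF α x).choose_spec
  have h2 := eq_timeOne hF fun t _ => isMIntegralCurve_hamVec_of_vectorField h1 t
  rw [h0] at h2
  exact h2

/-- For small β the flow stays in one chart up to time 1; there it is the smooth local flow, by
uniqueness of integral curves. -/
theorem contMDiffAt_timeOne_zero (x : M) :
    ContMDiffAt (𝓘(ℝ, 𝔻 n).prod 𝓘(ℝ, E)) 𝓘(ℝ, E) ∞
      (fun q : 𝔻 n × M => F.timeOne hF q.1 q.2) (0, x) := by
  let e := chartAt E x
  have he : e ∈ IsManifold.maximalAtlas 𝓘(ℝ, E) ∞ M := IsManifold.chart_mem_maximalAtlas x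
  have hx : x ∈ e.source := mem_chart_source E x
  obtain ⟨Φ, hΦ, hev⟩ := exists_contDiffAt_localFlow (ContinuousLinearMap.id ℝ (𝔻 n →L[ℝ] E))
    e.open_target (F.contDiffOn_hamChart he) (e.map_source hx)
  have hin : ContMDiffAt (𝓘(ℝ, 𝔻 n).prod 𝓘(ℝ, E)) 𝓘(ℝ, 𝔻 n × E) ∞
      (fun q : 𝔻 n × M => (q.1, e q.2)) (0, x) := by
    rw [modelWithCornersSelf_prod, ← chartedSpaceSelf_prod]
    exact contMDiffAt_fst.prodMk
      ((contMDiffAt_of_mem_maximalAtlas he hx).comp ((0 : 𝔻 n), x) contMDiffAt_snd)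
  have hΦ' : ContMDiffAt (𝓘(ℝ, 𝔻 n).prod 𝓘(ℝ, E)) 𝓘(ℝ, E) ∞
      (fun q : 𝔻 n × M => Φ (q.1, e q.2)) (0, x) :=
    ContMDiffAt.comp _ hΦ.contMDiffAt hin
  have hall : ∀ᶠ q in 𝓝 ((0 : 𝔻 n), x), q.2 ∈ e.source ∧ Φ (q.1, e q.2) ∈ e.target ∧
      F.timeOne hF q.1 q.2 = e.symm (Φ (q.1, e q.2)) := by
    have h1 : ∀ᶠ q in 𝓝 ((0 : 𝔻 n), x), q.2 ∈ e.source :=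
      continuousAt_snd.eventually_mem (e.open_source.mem_nhds hx)
    filter_upwards [h1, hin.continuousAt.eventually hev] with q hq ⟨c, hc0, hc1, hc⟩
    have h2 : ∀ t ∈ Set.Ioo (-2 : ℝ) 2,
        HasVelocityAt 𝓘(ℝ, E) (fun t => e.symm (c t)) (F.hamVec q.1 (e.symm (c t))) t := by
      intro t ht
      obtain ⟨h3, h4⟩ := hc t ht
      have h5 := (hasVelocityAt_iff_hasDerivAt.2 h4).comp
        ((OpenPartialHomeomorph.mdifferentiable_of_mem_maximalAtlas he).mdifferentiableAt_symm h3)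
      have h6 := F.mderiv_symm_hamChart he h3 q.1
      rw [← h6]
      exact h5
    have h7 := eq_timeOne hF h2
    simp only [hc0, hc1, e.left_inv hq] at h7
    exact ⟨hq, hc1 ▸ (hc 1 (by norm_num)).1, h7.symm⟩
  have hself := hall.self_of_nhds
  have hs : ContMDiffAt 𝓘(ℝ, E) 𝓘(ℝ, E) ∞ e.symm (Φ ((0 : 𝔻 n), e x)) :=
    contMDiffAt_symm_of_mem_maximalAtlas he hself.2.1
  exact (ContMDiffAt.comp ((0 : 𝔻 n), x) hs hΦ').congr_of_eventuallyEq
    (hall.mono fun q hq => hq.2.2)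

/-- φ_β is the N-fold iterate of φ_{β/N}. For large N the covector β/N is small enough for local
smoothness at all points of the compact orbit segment at once, by the tube lemma. -/
theorem contMDiff_timeOne :
    ContMDiff (𝓘(ℝ, 𝔻 n).prod 𝓘(ℝ, E)) 𝓘(ℝ, E) ∞
      (fun q : 𝔻 n × M => F.timeOne hF q.1 q.2) := by
  -- Finite order is needed because being C^m at a point is an open condition for finite m.
  refine contMDiff_infty.2 fun m => ?_
  rintro ⟨β, x⟩
  let S : Set (𝔻 n × M) := {q | ContMDiffAt (𝓘(ℝ, 𝔻 n).prod 𝓘(ℝ, E)) 𝓘(ℝ, E) m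
      (fun q : 𝔻 n × M => F.timeOne hF q.1 q.2) q}
  have : IsManifold 𝓘(ℝ, E) m M := IsManifold.of_le (n := ∞) (by exact_mod_cast le_top)
  have hSo : IsOpen S := by
    rw [isOpen_iff_mem_nhds]
    intro q hq
    exact (contMDiffAt_iff_contMDiffAt_nhds (by simp)).1 hq
  have hcont : Continuous fun t : ℝ => F.timeOne hF (t • β) x :=
    continuous_iff_continuousAt.2 fun t =>
      (hasVelocityAt_timeOne hF β x t).mdifferentiableAt.continuousAt
  let K : Set M := (fun t : ℝ => F.timeOne hF (t • β) x) '' Set.Icc 0 1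
  have hK : IsCompact K := isCompact_Icc.image hcont
  have hsub : ({0} : Set (𝔻 n)) ×ˢ K ⊆ S := by
    rintro ⟨b, y⟩ ⟨hb, -⟩
    obtain rfl : b = 0 := hb
    exact (contMDiffAt_timeOne_zero hF y).of_le (by exact_mod_cast le_top)
  obtain ⟨U, W, hU, -, hU0, hKW, hUW⟩ := generalized_tube_lemma isCompact_singleton hK hSo hsub
  obtain ⟨N, hN0, hN⟩ : ∃ N : ℕ, 0 < N ∧ ((N : ℝ)⁻¹) • β ∈ U := by
    have h1 : Filter.Tendsto (fun N : ℕ => ((N : ℝ)⁻¹) • β) Filter.atTop (𝓝 0) := by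
      simpa using (tendsto_inv_atTop_nhds_zero_nat (𝕜 := ℝ)).smul_const β
    obtain ⟨N, hN⟩ := ((h1.eventually_mem (hU.mem_nhds (hU0 rfl))).and
      (Filter.eventually_gt_atTop 0)).exists
    exact ⟨N, hN.2, hN.1⟩
  have hN0' : (N : ℝ) ≠ 0 := by positivity
  have hstep : ∀ k : ℕ, k ≤ N → ContMDiffAt (𝓘(ℝ, 𝔻 n).prod 𝓘(ℝ, E)) 𝓘(ℝ, E) m
      (fun q : 𝔻 n × M => F.timeOne hF (((k : ℝ) * (N : ℝ)⁻¹) • q.1) q.2) (β, x) := by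
    intro k
    induction k with
    | zero =>
      intro _
      simp only [Nat.cast_zero, zero_mul, zero_smul, timeOne_zero]
      exact contMDiffAt_snd
    | succ k ih =>
      intro hk
      have h1 := ih (by omega)
      have h2 : ((N : ℝ)⁻¹ • β, F.timeOne hF (((k : ℝ) * (N : ℝ)⁻¹) • β) x) ∈ S := by
        refine hUW ⟨hN, hKW ⟨_, ⟨by positivity, ?_⟩, rfl⟩⟩
        rw [← div_eq_mul_inv]
        exact div_le_one_of_le₀ (by exact_mod_cast (by omega : k ≤ N)) (by positivity)
      have h3 : ContMDiffAt (𝓘(ℝ, 𝔻 n).prod 𝓘(ℝ, E)) (𝓘(ℝ, 𝔻 n).prod 𝓘(ℝ, E)) m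
          (fun q : 𝔻 n × M =>
            ((N : ℝ)⁻¹ • q.1, F.timeOne hF (((k : ℝ) * (N : ℝ)⁻¹) • q.1) q.2)) (β, x) :=
        ((contDiff_const_smul (N : ℝ)⁻¹).contMDiff.contMDiffAt.comp (β, x)
          contMDiffAt_fst).prodMk h1
      have h2' : ContMDiffAt (𝓘(ℝ, 𝔻 n).prod 𝓘(ℝ, E)) 𝓘(ℝ, E) m
        (fun q : 𝔻 n × M => F.timeOne hF q.1 q.2)
        ((N : ℝ)⁻¹ • β, F.timeOne hF (((k : ℝ) * (N : ℝ)⁻¹) • β) x) := h2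
      have h4 := ContMDiffAt.comp (β, x) h2' h3
      refine h4.congr_of_eventuallyEq (Filter.Eventually.of_forall fun q => ?_)
      simp only [Function.comp_apply]
      rw [← timeOne_add_smul]
      congr 2
      push_cast
      ring
  have h := hstep N le_rfl
  simpa only [mul_inv_cancel₀ hN0', one_smul] using h

end Unique

end LagrangianFibration

/-! ### The symplectic action of covectors. -/

section TwoVariables

variable {E : Type*} [NormedAddCommGroup E] [NormedSpace ℝ E]
  {M : Type*} [TopologicalSpace M] [ChartedSpace E M]

theorem HasVelocityAt.diag {f : ℝ × ℝ → M} {v w : E} {t : ℝ}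
    (hf : MDifferentiableAt 𝓘(ℝ, ℝ × ℝ) 𝓘(ℝ, E) f (t, t))
    (hv : HasVelocityAt 𝓘(ℝ, E) (fun s => f (s, t)) v t)
    (hw : HasVelocityAt 𝓘(ℝ, E) (fun s => f (t, s)) w t) :
    HasVelocityAt 𝓘(ℝ, E) (fun s => f (s, s)) (v + w) t := by
  have h1 : HasVelocityAt 𝓘(ℝ, ℝ × ℝ) (fun s : ℝ => (s, t)) (1, 0) t :=
    hasVelocityAt_iff_hasDerivAt.2 ((hasDerivAt_id t).prodMk (hasDerivAt_const t t))
  have h2 : HasVelocityAt 𝓘(ℝ, ℝ × ℝ) (fun s : ℝ => (t, s)) (0, 1) t :=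
    hasVelocityAt_iff_hasDerivAt.2 ((hasDerivAt_const t t).prodMk (hasDerivAt_id t))
  have h3 : HasVelocityAt 𝓘(ℝ, ℝ × ℝ) (fun s : ℝ => (s, s)) (1, 1) t :=
    hasVelocityAt_iff_hasDerivAt.2 ((hasDerivAt_id t).prodMk (hasDerivAt_id t))
  have h4 := (HasVelocityAt.comp (γ := fun s : ℝ => (s, t)) hf h1).unique hv
  have h5 := (HasVelocityAt.comp (γ := fun s : ℝ => (t, s)) hf h2).unique hw
  have h6 := HasVelocityAt.comp (γ := fun s : ℝ => (s, s)) hf h3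
  have h7 : ((1, 1) : ℝ × ℝ) = (1, 0) + (0, 1) := by simp
  rw [h7, map_add, h4, h5] at h6
  exact h6

end TwoVariables

namespace LagrangianFibration

variable {n : ℕ} {B : Opens (𝔼 n)}
  {E : Type*} [NormedAddCommGroup E] [NormedSpace ℝ E]
  {M : Type*} [TopologicalSpace M] [ChartedSpace E M] [FiniteDimensional ℝ E]
  [T2Space M] [IsManifold 𝓘(ℝ, E) ∞ M] {F : LagrangianFibration B E M} (hF : F.IsComplete)

theorem contMDiff_timeOne_right (β : 𝔻 n) :
    ContMDiff 𝓘(ℝ, E) 𝓘(ℝ, E) ∞ (F.timeOne hF β) :=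
  (contMDiff_timeOne hF).comp (contMDiff_const.prodMk contMDiff_id)

theorem contMDiff_timeOne_left (x : M) :
    ContMDiff 𝓘(ℝ, 𝔻 n) 𝓘(ℝ, E) ∞ (fun β => F.timeOne hF β x) :=
  (contMDiff_timeOne hF).comp (contMDiff_id.prodMk contMDiff_const)

theorem mdifferentiableAt_timeOne_right (β : 𝔻 n) (x : M) :
    MDifferentiableAt 𝓘(ℝ, E) 𝓘(ℝ, E) (F.timeOne hF β) x :=
  (contMDiff_timeOne_right hF β).mdifferentiable (by simp) x

theorem dbase_mderiv_timeOne (β : 𝔻 n) (x : M) (v : E) :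
    F.dbase (F.timeOne hF β x) (mderiv 𝓘(ℝ, E) 𝓘(ℝ, E) (F.timeOne hF β) x v) = F.dbase x v := by
  have h := mderiv_comp (F.mdifferentiableAt_base (F.timeOne hF β x))
    (mdifferentiableAt_timeOne_right hF β x)
  have h2 : (fun y => F.base (F.timeOne hF β y)) = F.base := funext fun y => base_timeOne hF β y
  rw [h2] at h
  exact (congrArg (fun A : E →L[ℝ] 𝔼 n => A v) h).symm

/-- The flow of `X_β` written in a chart. -/
def chartFlow (e : OpenPartialHomeomorph M E) (β : 𝔻 n) (z : ℝ × E) : E :=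
  e (F.timeOne hF (z.1 • β) (e.symm z.2))

theorem contDiffAt_chartFlow {e : OpenPartialHomeomorph M E}
    (he : e ∈ IsManifold.maximalAtlas 𝓘(ℝ, E) ∞ M) (β : 𝔻 n) {z : ℝ × E} (hz : z.2 ∈ e.target)
    (hz' : F.timeOne hF (z.1 • β) (e.symm z.2) ∈ e.source) :
    ContDiffAt ℝ ∞ (chartFlow hF e β) z := by
  rw [← contMDiffAt_iff_contDiffAt]
  have h1 : ContMDiffAt 𝓘(ℝ, ℝ × E) (𝓘(ℝ, 𝔻 n).prod 𝓘(ℝ, E)) ∞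
      (fun z : ℝ × E => (z.1 • β, e.symm z.2)) z := by
    refine ContMDiffAt.prodMk ?_ ?_
    · exact (contDiff_fst.smul contDiff_const).contMDiff.contMDiffAt
    · exact (contMDiffAt_symm_of_mem_maximalAtlas he hz).comp z contDiff_snd.contMDiff.contMDiffAt
  have h2 := ((contMDiff_timeOne hF).contMDiffAt (x := (z.1 • β, e.symm z.2))).comp z h1
  exact (contMDiffAt_of_mem_maximalAtlas he hz').comp z h2

theorem hasDerivAt_form_timeOne_zero (β : 𝔻 n) (x : M) (v w : E) :
    HasDerivAt (fun s : ℝ => F.form (F.timeOne hF (s • β) x)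
      ![mderiv 𝓘(ℝ, E) 𝓘(ℝ, E) (F.timeOne hF (s • β)) x v,
        mderiv 𝓘(ℝ, E) 𝓘(ℝ, E) (F.timeOne hF (s • β)) x w]) 0 0 := by
  let e := chartAt E x
  have he : e ∈ IsManifold.maximalAtlas 𝓘(ℝ, E) ∞ M := IsManifold.chart_mem_maximalAtlas x
  have hx : x ∈ e.source := mem_chart_source E x
  have hxt := e.map_source hx
  have hed := OpenPartialHomeomorph.mdifferentiable_of_mem_maximalAtlas he
  let g := chartFlow hF e β
  let k : E → 𝔼 n := fun y => F.base (e.symm y)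
  have hk : ∀ y ∈ e.target, DifferentiableAt ℝ k y := fun y hy =>
    ((F.contDiffOn_base_symm he).contDiffAt (e.open_target.mem_nhds hy)).differentiableAt (by simp)
  have h00 : F.timeOne hF ((0 : ℝ) • β) (e.symm (e x)) = x := by
    rw [zero_smul, timeOne_zero, e.left_inv hx]
  have hev : ∀ᶠ z in 𝓝 ((0 : ℝ), e x), z.2 ∈ e.target ∧
      F.timeOne hF (z.1 • β) (e.symm z.2) ∈ e.source := by
    have h1 : ContinuousAt (fun z : ℝ × E => F.timeOne hF (z.1 • β) (e.symm z.2)) (0, e x) := by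
      refine ContinuousAt.comp (f := fun z : ℝ × E => (z.1 • β, e.symm z.2))
        (contMDiff_timeOne hF).continuous.continuousAt ?_
      refine (continuous_fst.smul continuous_const).continuousAt.prodMk ?_
      exact ContinuousAt.comp (f := Prod.snd) (e.continuousAt_symm hxt) continuousAt_snd
    refine (continuousAt_snd.eventually_mem (e.open_target.mem_nhds hxt)).and
      (h1.eventually_mem (e.open_source.mem_nhds ?_))
    exact h00.symm ▸ hx
  have hfib : ∀ z : ℝ × E, z.2 ∈ e.target ∧ F.timeOne hF (z.1 • β) (e.symm z.2) ∈ e.source →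
      k (g z) = k z.2 := by
    rintro z ⟨-, hz⟩
    change F.base (e.symm (e _)) = F.base _
    rw [e.left_inv hz, base_timeOne]
  have hg : ∀ z : ℝ × E, z.2 ∈ e.target ∧ F.timeOne hF (z.1 • β) (e.symm z.2) ∈ e.source →
      DifferentiableAt ℝ g z := fun z hz =>
    (contDiffAt_chartFlow hF he β hz.1 hz.2).differentiableAt (by simp)
  have hslice : ∀ z : ℝ × E, DifferentiableAt ℝ g z → ∀ c, fderiv ℝ (fun y => g (z.1, y)) z.2 c =
      fderiv ℝ g z (0, c) := by
    intro z hz c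
    have h1 : HasFDerivAt (fun y : E => (z.1, y)) (ContinuousLinearMap.inr ℝ ℝ E) z.2 :=
      hasFDerivAt_prodMk_right z.1 z.2
    have h2 := (HasFDerivAt.comp z.2 (f := fun y : E => (z.1, y)) (g := g) hz.hasFDerivAt h1).fderiv
    exact congrArg (fun A : E →L[ℝ] E => A c) h2
  -- The Cartan hypothesis with h = β ∘ π: ω(X_β, dφ c) = β(dπ(dφ c)) = β(dπ c), because π ∘ φ = π.
  have hc : ∀ᶠ z in 𝓝 ((0 : ℝ), e x), ∀ c,
      twoFormInChart F.symplecticForm.toForm e (g z) ![fderiv ℝ g z (1, 0), fderiv ℝ g z (0, c)] =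
        fderiv ℝ (fun y => β (k y)) z.2 c := by
    filter_upwards [hev.eventually_nhds] with z hz c
    have hz0 := hz.self_of_nhds
    have hgt : g z ∈ e.target := e.map_source hz0.2
    have h1 : fderiv ℝ g z (1, 0) = F.hamChart e (g z) β := by
      have h2 := HasVelocityAt.comp (γ := fun t : ℝ => F.timeOne hF (t • β) (e.symm z.2))
        (hed.mdifferentiableAt hz0.2) (hasVelocityAt_timeOne hF β (e.symm z.2) z.1)
      have h3 : HasDerivAt (fun s : ℝ => (s, z.2)) (1, 0) z.1 :=
        (hasDerivAt_id z.1).prodMk (hasDerivAt_const z.1 z.2)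
      have h4 := HasFDerivAt.comp_hasDerivAt z.1 (f := fun s : ℝ => (s, z.2)) (l := g)
        (hg z hz0).hasFDerivAt h3
      rw [h4.unique (hasVelocityAt_iff_hasDerivAt.1 h2)]
      exact (F.hamChart_apply he hz0.2 β).symm
    rw [h1, twoFormInChart_apply, F.mderiv_symm_hamChart he hgt, form_hamVec,
      ← F.fderiv_base_symm he hgt]
    have h5 : fderiv ℝ (fun y => β (k y)) z.2 c = β (fderiv ℝ k z.2 c) := by
      have := (HasFDerivAt.comp z.2 β.hasFDerivAt (hk z.2 hz0.1).hasFDerivAt).fderiv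
      exact congrArg (fun A : E →L[ℝ] ℝ => A c) this
    rw [h5, ← hslice z (hg z hz0) c]
    congr 1
    have h6 : (fun y => k (g (z.1, y))) =ᶠ[𝓝 z.2] k := by
      have h7 : Filter.Tendsto (fun y : E => (z.1, y)) (𝓝 z.2) (𝓝 z) :=
        (Continuous.prodMk_right z.1).tendsto z.2
      exact (h7.eventually hz).mono fun y hy => hfib _ hy
    have h8 : DifferentiableAt ℝ (fun y => g (z.1, y)) z.2 :=
      DifferentiableAt.comp z.2 (f := fun y : E => (z.1, y)) (hg z hz0)
        (hasFDerivAt_prodMk_right z.1 z.2).differentiableAt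
    have h9 := fderiv_comp z.2 (g := k) (f := fun y => g (z.1, y)) (hk _ hgt) h8
    rw [← h6.fderiv_eq]
    exact (congrArg (fun A : E →L[ℝ] 𝔼 n => A c) h9).symm
  have hσt : g (0, e x) ∈ e.target := e.map_source hev.self_of_nhds.2
  have hmain := hasDerivAt_pullback_of_extDeriv_eq_zero
    (a := mderiv 𝓘(ℝ, E) 𝓘(ℝ, E) e x v) (b := mderiv 𝓘(ℝ, E) 𝓘(ℝ, E) e x w)
    (contDiffAt_chartFlow hF he β hev.self_of_nhds.1 hev.self_of_nhds.2)
    ((F.symplecticForm.smooth e he).contDiffAt (e.open_target.mem_nhds hσt))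
    (F.symplecticForm.closed e he _ hσt)
    (β.contDiff.contDiffAt.comp (e x)
      ((F.contDiffOn_base_symm he).contDiffAt (e.open_target.mem_nhds hxt))) hc
  refine hmain.congr_of_eventuallyEq ?_
  have h10 : Filter.Tendsto (fun s : ℝ => (s, e x)) (𝓝 0) (𝓝 (0, e x)) :=
    (Continuous.prodMk_left (e x)).tendsto 0
  filter_upwards [h10.eventually hev] with s hs
  have hgt : g (s, e x) ∈ e.target := e.map_source hs.2
  have hex : F.timeOne hF (s • β) x ∈ e.source := by
    have := hs.2
    rwa [e.left_inv hx] at this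
  have hgx : g (s, e x) = e (F.timeOne hF (s • β) x) := by
    change e (F.timeOne hF (s • β) (e.symm (e x))) = _
    rw [e.left_inv hx]
  have hd : ∀ u : E, mderiv 𝓘(ℝ, E) 𝓘(ℝ, E) e.symm (g (s, e x))
      (fderiv ℝ g (s, e x) (0, mderiv 𝓘(ℝ, E) 𝓘(ℝ, E) e x u)) =
      mderiv 𝓘(ℝ, E) 𝓘(ℝ, E) (F.timeOne hF (s • β)) x u := by
    intro u
    rw [← hslice (s, e x) (hg _ hs), ← mderiv_eq_fderiv, hgx]
    have hm : MDifferentiableAt 𝓘(ℝ, E) 𝓘(ℝ, E)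
        (fun y => F.timeOne hF (s • β) (e.symm y)) (e x) := by
      have h11 := mdifferentiableAt_timeOne_right hF (s • β) (e.symm (e x))
      exact h11.comp (e x) (hed.mdifferentiableAt_symm hxt)
    have h12 := mderiv_comp (g := e) (f := fun y => F.timeOne hF (s • β) (e.symm y)) (x := e x)
      (hed.mdifferentiableAt hs.2) hm
    have h13 := mderiv_comp (g := F.timeOne hF (s • β)) (f := e.symm) (x := e x)
      (mdifferentiableAt_timeOne_right hF (s • β) (e.symm (e x))) (hed.mdifferentiableAt_symm hxt)
    have h14 := congrArg (fun A : E →L[ℝ] E => A (mderiv 𝓘(ℝ, E) 𝓘(ℝ, E) e x u)) h12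
    rw [h13] at h14
    simp only [ContinuousLinearMap.comp_apply, mderiv_symm_apply_mderiv he hx, e.left_inv hx] at h14
    refine (congrArg _ h14).trans (mderiv_symm_apply_mderiv he hex _)
  change _ = twoFormInChart F.symplecticForm.toForm e (g (s, e x)) ![_, _]
  rw [twoFormInChart_apply, hd, hd, hgx, e.left_inv hex]

theorem mderiv_timeOne_add_smul (β : 𝔻 n) (s t : ℝ) (x : M) (v : E) :
    mderiv 𝓘(ℝ, E) 𝓘(ℝ, E) (F.timeOne hF ((s + t) • β)) x v =
      mderiv 𝓘(ℝ, E) 𝓘(ℝ, E) (F.timeOne hF (s • β)) (F.timeOne hF (t • β) x)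
        (mderiv 𝓘(ℝ, E) 𝓘(ℝ, E) (F.timeOne hF (t • β)) x v) := by
  have h := mderiv_comp (mdifferentiableAt_timeOne_right hF (s • β) (F.timeOne hF (t • β) x))
    (mdifferentiableAt_timeOne_right hF (t • β) x)
  rw [← show F.timeOne hF ((s + t) • β) = _ from funext (timeOne_add_smul hF β s t)] at h
  exact congrArg (fun A : E →L[ℝ] E => A v) h

/-- The time-one maps preserve the symplectic form. -/
theorem form_timeOne (β : 𝔻 n) (x : M) (v w : E) :
    F.form (F.timeOne hF β x) ![mderiv 𝓘(ℝ, E) 𝓘(ℝ, E) (F.timeOne hF β) x v,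
      mderiv 𝓘(ℝ, E) 𝓘(ℝ, E) (F.timeOne hF β) x w] = F.form x ![v, w] := by
  let f : ℝ → ℝ := fun s => F.form (F.timeOne hF (s • β) x)
      ![mderiv 𝓘(ℝ, E) 𝓘(ℝ, E) (F.timeOne hF (s • β)) x v,
        mderiv 𝓘(ℝ, E) 𝓘(ℝ, E) (F.timeOne hF (s • β)) x w]
  have hf : ∀ t, HasDerivAt f 0 t := by
    intro t
    -- The group law in t moves the vanishing derivative from time 0 to an arbitrary time.
    have h1 := hasDerivAt_form_timeOne_zero hF β (F.timeOne hF (t • β) x)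
      (mderiv 𝓘(ℝ, E) 𝓘(ℝ, E) (F.timeOne hF (t • β)) x v)
      (mderiv 𝓘(ℝ, E) 𝓘(ℝ, E) (F.timeOne hF (t • β)) x w)
    simp only [← mderiv_timeOne_add_smul, ← timeOne_add_smul] at h1
    have h1' : HasDerivAt (fun s => f (s + t)) 0 (t - t) := by rw [sub_self]; exact h1
    have h2 := HasDerivAt.comp_sub_const t t h1'
    simpa only [sub_add_cancel] using h2
  have h3 := is_const_of_deriv_eq_zero (fun t => (hf t).differentiableAt) (fun t => (hf t).deriv) 1 0
  have h4 : F.timeOne hF 0 = fun y => y := funext (timeOne_zero hF)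
  simpa only [f, one_smul, zero_smul, h4, mderiv_id, ContinuousLinearMap.id_apply] using h3

theorem timeOne_timeOne_neg (β : 𝔻 n) (x : M) : F.timeOne hF β (F.timeOne hF (-β) x) = x := by
  have h := timeOne_add_smul hF β 1 (-1) x
  have hn : (-1 : ℝ) • β = -β := neg_one_smul ℝ β
  rw [add_neg_cancel, zero_smul, timeOne_zero, one_smul, hn] at h
  exact h.symm

theorem surjective_mderiv_timeOne (β : 𝔻 n) (x : M) :
    Function.Surjective (mderiv 𝓘(ℝ, E) 𝓘(ℝ, E) (F.timeOne hF β) x) := by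
  intro v
  have h := mderiv_timeOne_add_smul hF β 1 (-1) (F.timeOne hF β x) v
  have h0 := timeOne_timeOne_neg hF (-β) x
  have h4 : F.timeOne hF 0 = fun y => y := funext (timeOne_zero hF)
  have hn : (-1 : ℝ) • β = -β := neg_one_smul ℝ β
  rw [hn] at h
  simp only [add_neg_cancel, zero_smul, one_smul, h4, mderiv_id] at h
  rw [neg_neg] at h0
  rw [h0] at h
  exact ⟨_, h.symm⟩

/-- The time-one maps preserve the fields `X_γ`. -/
theorem mderiv_timeOne_hamVec (β γ : 𝔻 n) (x : M) :
    mderiv 𝓘(ℝ, E) 𝓘(ℝ, E) (F.timeOne hF β) x (F.hamVec γ x) =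
      F.hamVec γ (F.timeOne hF β x) := by
  refine F.eq_hamVec fun v => ?_
  -- Testing against images dφ u suffices, and both ω and dπ are invariant there.
  obtain ⟨u, rfl⟩ := surjective_mderiv_timeOne hF β x v
  rw [form_timeOne, form_hamVec, dbase_mderiv_timeOne]

/-- φ_β preserves X_γ, so it carries integral curves of X_γ to integral curves of X_γ. -/
theorem timeOne_comm_smul (β γ : 𝔻 n) (t : ℝ) (x : M) :
    F.timeOne hF β (F.timeOne hF (t • γ) x) = F.timeOne hF (t • γ) (F.timeOne hF β x) := by
  have h1 : ∀ t, HasVelocityAt 𝓘(ℝ, E) (fun t : ℝ => F.timeOne hF β (F.timeOne hF (t • γ) x))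
      (F.hamVec γ (F.timeOne hF β (F.timeOne hF (t • γ) x))) t := by
    intro t
    have h2 := HasVelocityAt.comp (γ := fun t : ℝ => F.timeOne hF (t • γ) x)
      (mdifferentiableAt_timeOne_right hF β (F.timeOne hF (t • γ) x))
      (hasVelocityAt_timeOne hF γ x t)
    rwa [mderiv_timeOne_hamVec] at h2
  have h3 := eq_timeOne_smul hF h1 t
  simpa only [zero_smul, timeOne_zero] using h3

/-- The time-one maps form an action of the additive group of covectors. -/
theorem timeOne_add (β γ : 𝔻 n) (x : M) :
    F.timeOne hF (β + γ) x = F.timeOne hF β (F.timeOne hF γ x) := by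
  have h1 : ∀ t, HasVelocityAt 𝓘(ℝ, E)
      (fun t : ℝ => F.timeOne hF (t • β) (F.timeOne hF (t • γ) x))
      (F.hamVec (β + γ) (F.timeOne hF (t • β) (F.timeOne hF (t • γ) x))) t := by
    intro t
    rw [hamVec_add]
    -- The velocity of φ_{tβ} φ_{tγ} x splits into two partial velocities; commutation brings φ_{tγ}
    -- outside to compute the second one.
    refine HasVelocityAt.diag
      (f := fun q : ℝ × ℝ => F.timeOne hF (q.1 • β) (F.timeOne hF (q.2 • γ) x)) ?_ ?_ ?_
    · have h2 : ContMDiff 𝓘(ℝ, ℝ × ℝ) 𝓘(ℝ, E) ∞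
          (fun q : ℝ × ℝ => F.timeOne hF (q.2 • γ) x) :=
        (contMDiff_timeOne_left hF x).comp (contDiff_snd.smul contDiff_const).contMDiff
      have h3 : ContMDiff 𝓘(ℝ, ℝ × ℝ) 𝓘(ℝ, E) ∞
          (fun q : ℝ × ℝ => F.timeOne hF (q.1 • β) (F.timeOne hF (q.2 • γ) x)) :=
        (contMDiff_timeOne hF).comp
          ((contDiff_fst.smul contDiff_const).contMDiff.prodMk h2)
      exact h3.mdifferentiable (by simp) _
    · exact hasVelocityAt_timeOne hF β _ t
    · have h2 := hasVelocityAt_timeOne hF γ (F.timeOne hF (t • β) x) t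
      simp only [← timeOne_comm_smul hF (t • β) γ] at h2
      exact h2
  have h4 := eq_timeOne hF fun t _ => h1 t
  simpa only [zero_smul, timeOne_zero, one_smul] using h4.symm

/-- Additivity writes φ_{tγ+β} x as the X_γ-orbit of φ_β x. -/
theorem mderiv_timeOne_left (β γ : 𝔻 n) (x : M) :
    mderiv 𝓘(ℝ, 𝔻 n) 𝓘(ℝ, E) (fun β => F.timeOne hF β x) β γ =
      F.hamVec γ (F.timeOne hF β x) := by
  have h1 : HasVelocityAt 𝓘(ℝ, 𝔻 n) (fun t : ℝ => t • γ + β) γ 0 := by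
    refine hasVelocityAt_iff_hasDerivAt.2 ?_
    simpa using ((hasDerivAt_id (0 : ℝ)).smul_const γ).add_const β
  have h0 : (fun t : ℝ => t • γ + β) 0 = β := by simp
  have h2 := h1.comp ((contMDiff_timeOne_left hF x).mdifferentiable (by simp) _)
  simp only [timeOne_add] at h2
  have h3 := hasVelocityAt_timeOne hF γ (F.timeOne hF β x) 0
  have h4 := h2.unique h3
  simpa only [zero_smul, zero_add, timeOne_zero] using h4

end LagrangianFibration

/-! ### Local coordinates, transitivity and periods as local 1-forms. -/

/-- A smooth map from a vector space to a manifold with bijective derivative at a point has a smooth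
local inverse. -/
theorem exists_contMDiffAt_localInverse {V E : Type*} [NormedAddCommGroup V] [NormedSpace ℝ V]
    [CompleteSpace V] [NormedAddCommGroup E] [NormedSpace ℝ E] [CompleteSpace E]
    {M : Type*} [TopologicalSpace M] [ChartedSpace E M] [IsManifold 𝓘(ℝ, E) ∞ M]
    {f : V → M} {a : V} (hf : ContMDiffAt 𝓘(ℝ, V) 𝓘(ℝ, E) ∞ f a)
    (hf' : Function.Bijective (mderiv 𝓘(ℝ, V) 𝓘(ℝ, E) f a)) :
    ∃ g : M → V, ContMDiffAt 𝓘(ℝ, E) 𝓘(ℝ, V) ∞ g (f a) ∧ g (f a) = a ∧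
      (∀ᶠ v in 𝓝 a, g (f v) = v) ∧ ∀ᶠ m in 𝓝 (f a), f (g m) = m := by
  let e := chartAt E (f a)
  have he : e ∈ IsManifold.maximalAtlas 𝓘(ℝ, E) ∞ M := IsManifold.chart_mem_maximalAtlas _
  have hx : f a ∈ e.source := mem_chart_source E _
  have hed := OpenPartialHomeomorph.mdifferentiable_of_mem_maximalAtlas he
  let G : V → E := fun v => e (f v)
  have heC : ContMDiffAt 𝓘(ℝ, E) 𝓘(ℝ, E) ∞ e (f a) := contMDiffAt_of_mem_maximalAtlas he hx
  have hG : ContDiffAt ℝ ∞ G a := contMDiffAt_iff_contDiffAt.1 (heC.comp a hf)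
  have hG' : fderiv ℝ G a = (mderiv 𝓘(ℝ, E) 𝓘(ℝ, E) e (f a)).comp (mderiv 𝓘(ℝ, V) 𝓘(ℝ, E) f a) := by
    rw [← mderiv_eq_fderiv]
    exact mderiv_comp (hed.mdifferentiableAt hx) (hf.mdifferentiableAt (by simp))
  have hbij : Function.Bijective (fderiv ℝ G a) := by
    have h1 : Function.Bijective (mderiv 𝓘(ℝ, E) 𝓘(ℝ, E) e (f a)) := by
      refine ⟨Function.LeftInverse.injective (mderiv_symm_apply_mderiv he hx), fun w =>
        ⟨mderiv 𝓘(ℝ, E) 𝓘(ℝ, E) e.symm (e (f a)) w, ?_⟩⟩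
      have h := mderiv_apply_mderiv_symm he (e.map_source hx) w
      rwa [e.left_inv hx] at h
    rw [hG']
    exact h1.comp hf'
  let L : V ≃L[ℝ] E := ContinuousLinearEquiv.ofBijective (fderiv ℝ G a)
    (LinearMap.ker_eq_bot.2 hbij.1) (LinearMap.range_eq_top.2 hbij.2)
  have hL : HasFDerivAt G (L : V →L[ℝ] E) a := (hG.differentiableAt (by simp)).hasFDerivAt
  have hS := hG.hasStrictFDerivAt' hL (by simp)
  let k := hG.localInverse hL (by simp)
  have hk : ContDiffAt ℝ ∞ k (G a) := hG.to_localInverse hL (by simp)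
  have hka : k (G a) = a := hG.localInverse_apply_image hL (by simp)
  have hkc : ContMDiffAt 𝓘(ℝ, E) 𝓘(ℝ, V) ∞ (fun m => k (e m)) (f a) :=
    hk.contMDiffAt.comp (f a) heC
  refine ⟨fun m => k (e m), hkc, hka, hS.eventually_left_inverse, ?_⟩
  have h1 : ∀ᶠ m in 𝓝 (f a), G (k (e m)) = e m :=
    (e.continuousAt hx).eventually hS.eventually_right_inverse
  have h2 : ∀ᶠ m in 𝓝 (f a), f (k (e m)) ∈ e.source := by
    have h3 : ContinuousAt (fun m => f (k (e m))) (f a) := by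
      refine ContinuousAt.comp (g := f) (f := fun m => k (e m)) ?_ hkc.continuousAt
      change ContinuousAt f (k (G a))
      rw [hka]
      exact hf.continuousAt
    refine h3.eventually_mem (e.open_source.mem_nhds ?_)
    change f (k (G a)) ∈ _
    rwa [hka]
  filter_upwards [h1, h2, e.open_source.mem_nhds hx] with m hm1 hm2 hm3
  exact e.injOn hm2 hm3 hm1

namespace LagrangianFibration

variable {n : ℕ} {B : Opens (𝔼 n)}
  {E : Type*} [NormedAddCommGroup E] [NormedSpace ℝ E]
  {M : Type*} [TopologicalSpace M] [ChartedSpace E M] [FiniteDimensional ℝ E]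
  [T2Space M] [IsManifold 𝓘(ℝ, E) ∞ M] {F : LagrangianFibration B E M} (hF : F.IsComplete)

/-- A smooth local section, moved by the action of the covectors, gives local coordinates. -/
theorem exists_fibre_coordinate {s : 𝔼 n → M} {b₀ : 𝔼 n}
    (hs : ContMDiffAt 𝓘(ℝ, 𝔼 n) 𝓘(ℝ, E) ∞ s b₀) (hsb : ∀ᶠ b in 𝓝 b₀, F.base (s b) = b)
    (β₀ : 𝔻 n) :
    ∃ τ : M → 𝔻 n, ContMDiffAt 𝓘(ℝ, E) 𝓘(ℝ, 𝔻 n) ∞ τ (F.timeOne hF β₀ (s b₀)) ∧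
      τ (F.timeOne hF β₀ (s b₀)) = β₀ ∧
      (∀ᶠ q in 𝓝 (b₀, β₀), τ (F.timeOne hF q.2 (s q.1)) = q.2) ∧
      ∀ᶠ m in 𝓝 (F.timeOne hF β₀ (s b₀)), F.timeOne hF (τ m) (s (F.base m)) = m := by
  have : CompleteSpace E := FiniteDimensional.complete ℝ E
  let f : 𝔼 n × 𝔻 n → M := fun q => F.timeOne hF q.2 (s q.1)
  have hf : ContMDiffAt 𝓘(ℝ, 𝔼 n × 𝔻 n) 𝓘(ℝ, E) ∞ f (b₀, β₀) := by
    have h1 : ContMDiffAt 𝓘(ℝ, 𝔼 n × 𝔻 n) 𝓘(ℝ, E) ∞ (fun q : 𝔼 n × 𝔻 n => s q.1) (b₀, β₀) :=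
      ContMDiffAt.comp (b₀, β₀) (f := Prod.fst) hs contDiff_fst.contMDiff.contMDiffAt
    exact ContMDiffAt.comp (b₀, β₀) ((contMDiff_timeOne hF).contMDiffAt (x := (β₀, s b₀)))
      (ContMDiffAt.prodMk contDiff_snd.contMDiff.contMDiffAt h1)
  have hfd := hf.mdifferentiableAt (by simp)
  set D := mderiv 𝓘(ℝ, 𝔼 n × 𝔻 n) 𝓘(ℝ, E) f (b₀, β₀) with hD
  have hD1 : ∀ q, F.dbase (f (b₀, β₀)) (D q) = q.1 := by
    intro q
    have h1 := mderiv_comp (F.mdifferentiableAt_base (f (b₀, β₀))) hfd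
    have h2 : (fun q => F.base (f q)) =ᶠ[𝓝 (b₀, β₀)] Prod.fst :=
      (continuousAt_fst.eventually hsb).mono fun q hq => (base_timeOne hF _ _).trans hq
    rw [h2.mderiv_eq, mderiv_eq_fderiv, fderiv_fst] at h1
    exact (congrArg (fun A : 𝔼 n × 𝔻 n →L[ℝ] 𝔼 n => A q) h1).symm
  have hD2 : ∀ γ, D (0, γ) = F.hamVec γ (f (b₀, β₀)) := by
    intro γ
    have h0 : HasFDerivAt (fun β : 𝔻 n => (b₀, β)) (ContinuousLinearMap.inr ℝ (𝔼 n) (𝔻 n)) β₀ :=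
      hasFDerivAt_prodMk_right b₀ β₀
    have h1 := mderiv_comp (g := f) (f := fun β : 𝔻 n => (b₀, β)) (x := β₀) hfd
      h0.hasMFDerivAt.mdifferentiableAt
    rw [h0.hasMFDerivAt.mderiv_eq] at h1
    have h2 := congrArg (fun A : 𝔻 n →L[ℝ] E => A γ) h1
    exact h2.symm.trans (mderiv_timeOne_left hF β₀ γ (s b₀))
  -- dπ detects the base component of D, and γ ↦ X_γ identifies covectors with vertical vectors.
  have hbij : Function.Bijective D := by
    constructor
    · rw [injective_iff_map_eq_zero]
      rintro ⟨v, γ⟩ h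
      have h1 : v = 0 := by
        have h2 := hD1 (v, γ)
        rw [h, map_zero] at h2
        exact h2.symm
      subst h1
      rw [hD2] at h
      rw [F.eq_zero_of_hamVec_eq_zero h]
      rfl
    · intro w
      obtain ⟨γ, hγ⟩ := F.exists_hamVec_eq (x := f (b₀, β₀))
        (v := w - D (F.dbase (f (b₀, β₀)) w, 0)) (by rw [map_sub, hD1, sub_self])
      refine ⟨(F.dbase (f (b₀, β₀)) w, 0) + (0, γ), ?_⟩
      rw [map_add, hD2, hγ, add_sub_cancel]
  obtain ⟨g, hg, hga, hg1, hg2⟩ := exists_contMDiffAt_localInverse hf hbij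
  have hbase : ∀ᶠ m in 𝓝 (f (b₀, β₀)), F.base (s (g m).1) = (g m).1 := by
    have h1 : Filter.Tendsto (fun m => (g m).1) (𝓝 (f (b₀, β₀))) (𝓝 b₀) := by
      have h2 : Filter.Tendsto (fun m => (g m).1) (𝓝 (f (b₀, β₀))) (𝓝 (g (f (b₀, β₀))).1) :=
        continuousAt_fst.comp hg.continuousAt
      rwa [hga] at h2
    exact h1.eventually hsb
  refine ⟨fun m => (g m).2, contDiff_snd.contMDiff.contMDiffAt.comp _ hg, ?_, ?_, ?_⟩
  · exact congrArg Prod.snd hga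
  · exact hg1.mono fun q hq => congrArg Prod.snd hq
  · filter_upwards [hg2, hbase] with m hm hb
    have h1 : F.base m = (g m).1 := by
      conv_lhs => rw [← hm]
      exact (base_timeOne hF _ _).trans hb
    rw [h1]
    exact hm

/-- Orbits are open in the fibres: in the coordinates around a section through x, nearby points of
the same fibre differ from x by a covector. -/
theorem eventually_exists_timeOne_eq (x : M) :
    ∀ᶠ y in 𝓝 x, F.base y = F.base x → ∃ β, F.timeOne hF β x = y := by
  obtain ⟨s, hs, hsx, hsb⟩ := F.exists_section x
  obtain ⟨τ, -, -, -, h⟩ := exists_fibre_coordinate hF hs hsb 0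
  rw [timeOne_zero, hsx] at h
  filter_upwards [h] with y hy hb
  rw [hb, hsx] at hy
  exact ⟨_, hy⟩

theorem timeOne_neg_timeOne (β : 𝔻 n) (x : M) : F.timeOne hF (-β) (F.timeOne hF β x) = x := by
  have h := timeOne_timeOne_neg hF (-β) x
  rwa [neg_neg] at h

/-- The covectors act transitively on the fibres. -/
theorem exists_timeOne_eq (hconn : ∀ b : B, IsConnected (F.proj ⁻¹' {b})) {x y : M}
    (h : F.base x = F.base y) : ∃ β, F.timeOne hF β x = y := by
  have hy : F.proj x = F.proj y := Subtype.ext h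
  refine (hconn (F.proj y)).isPreconnected.induction₂ (fun x y => ∃ β, F.timeOne hF β x = y)
    ?_ ?_ ?_ hy rfl
  · intro x hx
    filter_upwards [mem_nhdsWithin_of_mem_nhds (eventually_exists_timeOne_eq hF x),
      self_mem_nhdsWithin] with z hz hz'
    exact hz (congrArg Subtype.val ((show F.proj z = _ from hz').trans (show F.proj x = _ from hx).symm))
  · rintro x y z - - - ⟨β, rfl⟩ ⟨γ, rfl⟩
    exact ⟨γ + β, timeOne_add hF γ β x⟩
  · rintro x y - - ⟨β, rfl⟩
    exact ⟨-β, timeOne_neg_timeOne hF β x⟩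

/-- The period net, as a subset of `ℝⁿ × (ℝⁿ)^*`. -/
def periodSet : Set (𝔼 n × 𝔻 n) := {q | ∃ x, F.base x = q.1 ∧ F.timeOne hF q.2 x = x}

/-- The action is transitive on the fibre and abelian, so the stabilizer is the same at all its
points. -/
theorem mk_mem_periodSet_iff (hconn : ∀ b : B, IsConnected (F.proj ⁻¹' {b})) (x : M) (β : 𝔻 n) :
    (F.base x, β) ∈ periodSet hF ↔ F.timeOne hF β x = x := by
  refine ⟨?_, fun h => ⟨x, rfl, h⟩⟩
  rintro ⟨y, hy, h⟩
  obtain ⟨γ, rfl⟩ := exists_timeOne_eq hF hconn hy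
  change F.timeOne hF β y = y at h
  rw [← timeOne_add, add_comm, timeOne_add, h]

theorem mem_periodLattice_iff (hconn : ∀ b : B, IsConnected (F.proj ⁻¹' {b})) (b : B) (β : 𝔻 n) :
    β ∈ F.periodLattice hF b ↔ ((b : 𝔼 n), β) ∈ periodSet hF := by
  obtain ⟨x, rfl⟩ := F.surjective b
  constructor
  · rintro ⟨α, rfl, h⟩
    exact ⟨x, rfl, (flow_one hF α x).symm.trans (h x rfl)⟩
  · intro h
    obtain ⟨α, rfl⟩ := exists_compactOneForm (F.proj x) β
    refine ⟨α, rfl, fun y hy => ?_⟩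
    rw [flow_one, hy]
    refine (mk_mem_periodSet_iff hF hconn y _).1 ?_
    rwa [base, hy]

theorem mem_periodNet_iff (hconn : ∀ b : B, IsConnected (F.proj ⁻¹' {b})) (ξ : CotangentBundle B) :
    ξ ∈ F.periodNet hF ↔ ((ξ.1 : 𝔼 n), ξ.2) ∈ periodSet hF :=
  mem_periodLattice_iff hF hconn ξ.1 ξ.2

/-- Periods over b are the solutions of φ_β(s b) = s b. Since τ locally inverts β ↦ φ_β(s b), the
only solution near the given one is l(b) = τ(s b). -/
theorem exists_eventually_mem_periodSet_iff (hconn : ∀ b : B, IsConnected (F.proj ⁻¹' {b}))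
    {q₀ : 𝔼 n × 𝔻 n} (h₀ : q₀ ∈ periodSet hF) :
    ∃ l : 𝔼 n → 𝔻 n, ContDiffAt ℝ ∞ l q₀.1 ∧ l q₀.1 = q₀.2 ∧
      ∀ᶠ q in 𝓝 q₀, q ∈ periodSet hF ↔ q.2 = l q.1 := by
  obtain ⟨b₀, β₀⟩ := q₀
  obtain ⟨x, hx, hxβ⟩ := h₀
  obtain rfl : F.base x = b₀ := hx
  change F.timeOne hF β₀ x = x at hxβ
  obtain ⟨s, hs, hsx, hsb⟩ := F.exists_section x
  obtain ⟨τ, hτ, hτ0, hτ1, hτ2⟩ := exists_fibre_coordinate hF hs hsb β₀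
  rw [hsx, hxβ] at hτ hτ0 hτ2
  have hst : Filter.Tendsto s (𝓝 (F.base x)) (𝓝 x) := by
    have := hs.continuousAt.tendsto
    rwa [hsx] at this
  refine ⟨fun b => τ (s b), ?_, ?_, ?_⟩
  · rw [← contMDiffAt_iff_contDiffAt]
    refine ContMDiffAt.comp (F.base x) ?_ hs
    rwa [hsx]
  · change τ (s (F.base x)) = β₀
    rw [hsx, hτ0]
  · have h1 : Filter.Tendsto (fun q : 𝔼 n × 𝔻 n => q.1) (𝓝 (F.base x, β₀)) (𝓝 (F.base x)) :=
      continuousAt_fst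
    filter_upwards [hτ1, h1.eventually hsb, h1.eventually (hst.eventually hτ2)] with q hq1 hq2 hq3
    obtain ⟨b, β⟩ := q
    change F.base (s b) = b at hq2
    have h2 : (b, β) ∈ periodSet hF ↔ F.timeOne hF β (s b) = s b := by
      conv_lhs => rw [← hq2]
      exact mk_mem_periodSet_iff hF hconn _ _
    rw [h2]
    simp only at hq1 hq3
    rw [hq2] at hq3
    constructor
    · intro h
      rw [h] at hq1
      exact hq1.symm
    · intro h
      change β = τ (s b) at h
      rwa [h]

/-- Near each of its points the period net is the graph of a smooth closed `1`-form. -/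
theorem exists_periodSet_eq_graph (hconn : ∀ b : B, IsConnected (F.proj ⁻¹' {b}))
    {q₀ : 𝔼 n × 𝔻 n} (h₀ : q₀ ∈ periodSet hF) :
    ∃ (l : 𝔼 n → 𝔻 n) (U : Set (𝔼 n)) (W : Set (𝔼 n × 𝔻 n)), IsOpen U ∧ IsOpen W ∧ q₀ ∈ W ∧
      ContDiffOn ℝ ∞ l U ∧ (∀ q ∈ W, q.1 ∈ U) ∧ (∀ b ∈ U, (b, l b) ∈ W) ∧
      ∀ q ∈ W, q ∈ periodSet hF ↔ q.2 = l q.1 := by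
  obtain ⟨l, hl, hl0, hev⟩ := exists_eventually_mem_periodSet_iff hF hconn h₀
  obtain ⟨W₁, hW₁, hW₁o, hq₀⟩ := eventually_nhds_iff.1 hev
  have hgc : ∀ b, ContinuousAt l b → ContinuousAt (fun b => (b, l b)) b :=
    fun b hb => continuousAt_id.prodMk hb
  have hq₀' : (q₀.1, l q₀.1) = q₀ := by rw [hl0]
  -- Smoothness at one point yields C¹ nearby, which is used for continuity of l. Full smoothness at
  -- each b follows by reapplying the local lemma at (b, l b), whose function must agree with l near
  -- b.
  have h1 : ∀ᶠ b in 𝓝 q₀.1, (b, l b) ∈ W₁ ∧ ContDiffAt ℝ 1 l b := by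
    refine ((hgc _ hl.continuousAt).eventually_mem (hW₁o.mem_nhds ?_)).and
      ((hl.of_le (by simp)).eventually (by simp))
    rwa [hq₀']
  obtain ⟨U, hU, hUo, hqU⟩ := eventually_nhds_iff.1 h1
  refine ⟨l, U, W₁ ∩ Prod.fst ⁻¹' U, hUo, hW₁o.inter (hUo.preimage continuous_fst), ⟨hq₀, hqU⟩, ?_,
    fun q hq => hq.2, fun b hb => ⟨(hU b hb).1, hb⟩, fun q hq => hW₁ q hq.1⟩
  intro b hb
  refine ContDiffAt.contDiffWithinAt ?_
  obtain ⟨l', hl', hl0', hev'⟩ := exists_eventually_mem_periodSet_iff hF hconn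
    ((hW₁ (b, l b) (hU b hb).1).2 rfl)
  refine hl'.congr_of_eventuallyEq ?_
  filter_upwards [(hgc b (hU b hb).2.continuousAt).eventually hev', hUo.mem_nhds hb] with c hc hcU
  exact hc.1 ((hW₁ _ (hU c hcU).1).2 rfl)

/-- Differentiating φ_{l(π m)}(m) = m shows that dφ u = u − X_{dl(dπ u)} for the frozen period φ.
Since φ preserves ω and ω(X_β, X_γ) = 0, comparing ω(dφ v, dφ w) with ω(v, w) leaves the symmetry of
dl. -/
theorem fderiv_symm_of_mem_periodSet (hconn : ∀ b : B, IsConnected (F.proj ⁻¹' {b}))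
    {l : 𝔼 n → 𝔻 n} {b : 𝔼 n} (hl : DifferentiableAt ℝ l b)
    (h : ∀ᶠ c in 𝓝 b, (c, l c) ∈ periodSet hF) (v w : 𝔼 n) :
    fderiv ℝ l b v w = fderiv ℝ l b w v := by
  obtain ⟨x, hx, -⟩ := h.self_of_nhds
  obtain rfl : F.base x = b := hx
  have hfix : ∀ᶠ m in 𝓝 x, F.timeOne hF (l (F.base m)) m = m := by
    filter_upwards [F.contMDiff_base.continuous.continuousAt.eventually h] with m hm
    exact (mk_mem_periodSet_iff hF hconn m _).1 hm
  have hfx := hfix.self_of_nhds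
  have key : ∀ u : E, mderiv 𝓘(ℝ, E) 𝓘(ℝ, E) (F.timeOne hF (l (F.base x))) x u =
      u + F.hamVec (-fderiv ℝ l (F.base x) (F.dbase x u)) x := by
    intro u
    -- A straight line in a chart realizes u as a velocity, which reduces the derivative to a
    -- diagonal one in two time variables.
    obtain ⟨γ, hγ0, hγ⟩ : ∃ γ : ℝ → M, γ 0 = x ∧ HasVelocityAt 𝓘(ℝ, E) γ u 0 := by
      let e := chartAt E x
      have he : e ∈ IsManifold.maximalAtlas 𝓘(ℝ, E) ∞ M := IsManifold.chart_mem_maximalAtlas x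
      have hxs : x ∈ e.source := mem_chart_source E x
      have hed := OpenPartialHomeomorph.mdifferentiable_of_mem_maximalAtlas he
      let u' := mderiv 𝓘(ℝ, E) 𝓘(ℝ, E) e x u
      have h0 : e x + (0 : ℝ) • u' = e x := by rw [zero_smul, add_zero]
      have h1 : HasVelocityAt 𝓘(ℝ, E) (fun t : ℝ => e x + t • u') u' 0 := by
        refine hasVelocityAt_iff_hasDerivAt.2 ?_
        simpa using ((hasDerivAt_id (0 : ℝ)).smul_const u').const_add (e x)
      have h2 := HasVelocityAt.comp (f := e.symm) (γ := fun t : ℝ => e x + t • u')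
        (hed.mdifferentiableAt_symm (by simpa only [h0] using e.map_source hxs)) h1
      refine ⟨fun t => e.symm (e x + t • u'), by simp only [h0, e.left_inv hxs], ?_⟩
      simpa only [h0, u', mderiv_symm_apply_mderiv he hxs] using h2
    have hγ' := hγ.mdifferentiableAt
    have hb : HasVelocityAt 𝓘(ℝ, 𝔼 n) (fun t => F.base (γ t)) (F.dbase x u) 0 := by
      have h1 := hγ.comp (F.mdifferentiableAt_base (γ 0))
      rwa [hγ0] at h1
    have hlb : HasVelocityAt 𝓘(ℝ, 𝔻 n) (fun t => l (F.base (γ t)))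
        (fderiv ℝ l (F.base x) (F.dbase x u)) 0 := by
      have h1 := HasVelocityAt.comp (γ := fun t => F.base (γ t)) (f := l) (I' := 𝓘(ℝ, 𝔻 n))
        (by rw [hγ0]; exact hl.mdifferentiableAt) hb
      rwa [hγ0, mderiv_eq_fderiv] at h1
    have h1 : HasVelocityAt 𝓘(ℝ, E) (fun t => F.timeOne hF (l (F.base (γ t))) (γ 0))
        (F.hamVec (fderiv ℝ l (F.base x) (F.dbase x u)) x) 0 := by
      have h2 := HasVelocityAt.comp (γ := fun t => l (F.base (γ t)))
        (f := fun β => F.timeOne hF β (γ 0))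
        ((contMDiff_timeOne_left hF (γ 0)).mdifferentiable (by simp) _) hlb
      simp only [hγ0] at h2 ⊢
      rwa [mderiv_timeOne_left, hfx] at h2
    have h2 : HasVelocityAt 𝓘(ℝ, E) (fun t => F.timeOne hF (l (F.base (γ 0))) (γ t))
        (mderiv 𝓘(ℝ, E) 𝓘(ℝ, E) (F.timeOne hF (l (F.base x))) x u) 0 := by
      have h3 := hγ.comp (mdifferentiableAt_timeOne_right hF (l (F.base (γ 0))) (γ 0))
      simp only [hγ0] at h3 ⊢
      exact h3
    have h3 := HasVelocityAt.diag
      (f := fun q : ℝ × ℝ => F.timeOne hF (l (F.base (γ q.1))) (γ q.2)) (t := 0) ?_ h1 h2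
    · have h4 : HasVelocityAt 𝓘(ℝ, E) γ _ 0 := h3.congr (by
        have h5 : Filter.Tendsto γ (𝓝 0) (𝓝 x) := by
          have := hγ'.continuousAt.tendsto
          rwa [hγ0] at this
        exact (h5.eventually hfix).mono fun t ht => ht.symm)
      have h5 := hγ.unique h4
      rw [← neg_one_smul ℝ (fderiv ℝ l (F.base x) (F.dbase x u)), hamVec_smul, neg_one_smul,
        ← sub_eq_add_neg, eq_sub_iff_add_eq, add_comm]
      exact h5.symm
    · have h4 : MDifferentiableAt 𝓘(ℝ, ℝ × ℝ) 𝓘(ℝ, 𝔻 n)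
          (fun q : ℝ × ℝ => l (F.base (γ q.1))) (0, 0) :=
        MDifferentiableAt.comp (f := Prod.fst) (g := fun t => l (F.base (γ t))) ((0 : ℝ), (0 : ℝ))
          hlb.mdifferentiableAt differentiable_fst.mdifferentiable.mdifferentiableAt
      have h5 : MDifferentiableAt 𝓘(ℝ, ℝ × ℝ) 𝓘(ℝ, E) (fun q : ℝ × ℝ => γ q.2) (0, 0) :=
        MDifferentiableAt.comp (f := Prod.snd) (g := γ) ((0 : ℝ), (0 : ℝ))
          hγ' differentiable_snd.mdifferentiable.mdifferentiableAt
      exact MDifferentiableAt.comp ((0 : ℝ), (0 : ℝ))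
        ((contMDiff_timeOne hF).mdifferentiable (by simp) (l (F.base (γ 0)), γ 0)) (h4.prodMk h5)
  obtain ⟨v, rfl⟩ := F.surjective_dbase x v
  obtain ⟨w, rfl⟩ := F.surjective_dbase x w
  have h1 := form_timeOne hF (l (F.base x)) x v w
  rw [hfx, key, key, ContinuousAlternatingMap.pair_add_left,
    ContinuousAlternatingMap.pair_add_right, ContinuousAlternatingMap.pair_add_right,
    form_hamVec_hamVec, form_hamVec, ContinuousAlternatingMap.pair_swap _ v (F.hamVec _ x),
    form_hamVec] at h1
  simp only [neg_apply] at h1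
  linarith

end LagrangianFibration

/-! ### Graphs of closed 1-forms are Lagrangian submanifolds. -/

theorem StructureGroupoid.trans_mem_maximalAtlas {H M : Type*} [TopologicalSpace H]
    [TopologicalSpace M] [ChartedSpace H M] (G : StructureGroupoid H)
    {e : OpenPartialHomeomorph M H} {g : OpenPartialHomeomorph H H}
    (he : e ∈ G.maximalAtlas M) (hg : g ∈ G) : e.trans g ∈ G.maximalAtlas M := by
  intro e' he'
  obtain ⟨h1, h2⟩ := he e' he'
  constructor
  · rw [OpenPartialHomeomorph.trans_symm_eq_symm_trans_symm, OpenPartialHomeomorph.trans_assoc]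
    exact G.trans (G.symm hg) h1
  · rw [← OpenPartialHomeomorph.trans_assoc]
    exact G.trans h2 hg

section Graph

variable {n : ℕ} {B : Opens (𝔼 n)}

/-- A piece of `L ⊆ T^*B` which is the graph of a smooth closed `1`-form. -/
structure GraphChart (L : Set (CotangentBundle B)) where
  /-- The `1`-form. -/
  l : 𝔼 n → 𝔻 n
  /-- The domain of the `1`-form. -/
  U : Set (𝔼 n)
  /-- The open set in which `L` is the graph. -/
  W : Set (𝔼 n × 𝔻 n)
  isOpen_U : IsOpen U
  isOpen_W : IsOpen W
  contDiffOn : ContDiffOn ℝ ∞ l U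
  fst_mem : ∀ q ∈ W, q.1 ∈ U
  mk_mem : ∀ b ∈ U, (b, l b) ∈ W
  subset : ∀ b ∈ U, b ∈ B
  mem_iff : ∀ η : CotangentBundle B, ((η.1 : 𝔼 n), η.2) ∈ W → (η ∈ L ↔ η.2 = l η.1)
  fderiv_symm : ∀ b ∈ U, ∀ v w, fderiv ℝ l b v w = fderiv ℝ l b w v

/-- The shear `(b, β) ↦ (b, β - l b)`. -/
def shear (l : 𝔼 n → 𝔻 n) {U : Set (𝔼 n)} (hU : IsOpen U) (hl : ContinuousOn l U) :
    OpenPartialHomeomorph (CotangentModel n) (CotangentModel n) where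
  toFun q := (q.1, q.2 - l q.1)
  invFun q := (q.1, q.2 + l q.1)
  source := {q | q.1 ∈ U}
  target := {q | q.1 ∈ U}
  map_source' _ h := h
  map_target' _ h := h
  left_inv' q _ := Prod.ext rfl (sub_add_cancel q.2 (l q.1))
  right_inv' q _ := Prod.ext rfl (add_sub_cancel_right q.2 (l q.1))
  open_source := hU.preimage continuous_fst
  open_target := hU.preimage continuous_fst
  continuousOn_toFun := continuousOn_fst.prodMk
    (continuousOn_snd.sub (hl.comp continuousOn_fst fun _ h => h))
  continuousOn_invFun := continuousOn_fst.prodMk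
    (continuousOn_snd.add (hl.comp continuousOn_fst fun _ h => h))

theorem shear_mem_contDiffGroupoid {l : 𝔼 n → 𝔻 n} {U : Set (𝔼 n)} (hU : IsOpen U)
    (hl : ContDiffOn ℝ ∞ l U) :
    shear l hU hl.continuousOn ∈ contDiffGroupoid ∞ (cotangentI n) := by
  have h1 : ContDiffOn ℝ ∞ (fun q : 𝔼 n × 𝔻 n => l q.1) {q | q.1 ∈ U} :=
    hl.comp contDiffOn_fst fun _ h => h
  rw [contDiffGroupoid, mem_groupoid_of_pregroupoid]
  constructor
  · exact ((contDiffOn_fst.prodMk (contDiffOn_snd.sub h1)).mono Set.inter_subset_left :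
      ContDiffOn ℝ ∞ (fun q : 𝔼 n × 𝔻 n => (q.1, q.2 - l q.1)) _)
  · exact ((contDiffOn_fst.prodMk (contDiffOn_snd.add h1)).mono Set.inter_subset_left :
      ContDiffOn ℝ ∞ (fun q : 𝔼 n × 𝔻 n => (q.1, q.2 + l q.1)) _)

namespace GraphChart

variable {L : Set (CotangentBundle B)} (c : GraphChart L)

/-- The point of the graph over `b`. -/
def point (b : 𝔼 n) (hb : b ∈ c.U) : L :=
  ⟨(⟨b, c.subset b hb⟩, c.l b), (c.mem_iff _ (c.mk_mem b hb)).2 rfl⟩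

open Classical in
/-- The projection of a graph to its base, as a chart. -/
def chart (x : L) : OpenPartialHomeomorph L (𝔼 n) where
  toFun y := y.1.1
  -- The point x is only a default value outside U.
  invFun b := if h : b ∈ c.U then c.point b h else x
  source := {y | ((y.1.1 : 𝔼 n), y.1.2) ∈ c.W}
  target := c.U
  map_source' _ h := c.fst_mem _ h
  map_target' b h := by
    rw [dif_pos h]
    exact c.mk_mem b h
  left_inv' y h := by
    rw [dif_pos (c.fst_mem _ h)]
    exact Subtype.ext (Prod.ext rfl ((c.mem_iff y.1 h).1 y.2).symm)
  right_inv' b h := by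
    rw [dif_pos h]
    rfl
  open_source := c.isOpen_W.preimage ((continuous_subtype_val.comp
    (continuous_fst.comp continuous_subtype_val)).prodMk
    (continuous_snd.comp continuous_subtype_val))
  open_target := c.isOpen_U
  continuousOn_toFun := (continuous_subtype_val.comp
    (continuous_fst.comp continuous_subtype_val)).continuousOn
  continuousOn_invFun := by
    rw [continuousOn_iff_continuous_domRestrict]
    have h : (c.U.domRestrict fun b => if h : b ∈ c.U then c.point b h else x) =
        fun b : c.U => c.point b b.2 := by
      funext b
      exact dif_pos b.2
    rw [h]
    exact ((continuous_subtype_val.subtype_mk _).prodMk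
      (continuousOn_iff_continuous_domRestrict.1 c.contDiffOn.continuousOn)).subtype_mk _

theorem chart_symm_apply (x : L) {b : 𝔼 n} (hb : b ∈ c.U) : (c.chart x).symm b = c.point b hb :=
  dif_pos hb

end GraphChart

variable {L : Set (CotangentBundle B)}

/-- A set which is locally the graph of a smooth closed `1`-form is a manifold, with the projection
to the base as charts. -/
@[reducible]
def chartedSpaceOfGraphChart (c : L → GraphChart L)
    (hc : ∀ x : L, ((x.1.1 : 𝔼 n), x.1.2) ∈ (c x).W) : ChartedSpace (𝔼 n) L where
  atlas := Set.range fun x => (c x).chart x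
  chartAt x := (c x).chart x
  mem_chart_source := hc
  chart_mem_atlas x := ⟨x, rfl⟩

/-- All charts are the projection to the base, so the transition maps are restrictions of the
identity. -/
theorem isManifold_of_graphChart (c : L → GraphChart L)
    (hc : ∀ x : L, ((x.1.1 : 𝔼 n), x.1.2) ∈ (c x).W) :
    @IsManifold ℝ _ (𝔼 n) _ _ (𝔼 n) _ 𝓘(ℝ, 𝔼 n) ∞ L _ (chartedSpaceOfGraphChart c hc) := by
  let _ := chartedSpaceOfGraphChart c hc
  refine isManifold_of_contDiffOn _ _ _ ?_
  rintro e e' ⟨x, rfl⟩ ⟨x', rfl⟩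
  refine contDiffOn_id.congr fun b hb => ?_
  have hb1 : b ∈ (c x).U := hb.1.1
  change ((((c x).chart x).symm b).1.1 : 𝔼 n) = b
  rw [(c x).chart_symm_apply x hb1]
  rfl

/-- A set which is locally the graph of a smooth closed `1`-form is a Lagrangian submanifold. -/
theorem isLagrangianSubmanifold_of_graphChart (c : L → GraphChart L)
    (hc : ∀ x : L, ((x.1.1 : 𝔼 n), x.1.2) ∈ (c x).W) : IsLagrangianSubmanifold L := by
  let _ := chartedSpaceOfGraphChart c hc
  have := isManifold_of_graphChart c hc
  have himm : Manifold.IsImmersion 𝓘(ℝ, 𝔼 n) (cotangentI n) ∞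
      (Subtype.val : L → CotangentBundle B) := by
    refine Manifold.IsImmersionOfComplement.isImmersion (F := 𝔻 n) fun x => ?_
    -- After the shear the graph becomes the zero section, and the inclusion reads b ↦ (b, 0).
    refine Manifold.IsImmersionAtOfComplement.mk_of_continuousAt continuous_subtype_val.continuousAt
      (ContinuousLinearEquiv.refl ℝ (𝔼 n × 𝔻 n)) ((c x).chart x)
      ((chartAt (CotangentModel n) x.1).trans
        (shear (c x).l (c x).isOpen_U (c x).contDiffOn.continuousOn)) (hc x) ?_
      (IsManifold.chart_mem_maximalAtlas x)
      (StructureGroupoid.trans_mem_maximalAtlas _ (IsManifold.chart_mem_maximalAtlas x.1)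
        (shear_mem_contDiffGroupoid (c x).isOpen_U (c x).contDiffOn)) ?_
    · rw [OpenPartialHomeomorph.trans_source]
      exact ⟨mem_chart_source _ _, (c x).fst_mem _ (hc x)⟩
    · intro b hb
      have hb1 : b ∈ (c x).U := by
        rw [OpenPartialHomeomorph.extend_target] at hb
        exact hb.1
      change (((((c x).chart x).symm b).1.1 : 𝔼 n), (((c x).chart x).symm b).1.2 -
        (c x).l (((c x).chart x).symm b).1.1) = (b, (0 : 𝔻 n))
      rw [(c x).chart_symm_apply x hb1]
      exact Prod.ext rfl (sub_self _)
  refine ⟨inferInstance, inferInstance, ⟨himm, .subtypeVal⟩, fun x => ?_⟩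
  have hxU : (x.1.1 : 𝔼 n) ∈ (c x).U := (c x).fst_mem _ (hc x)
  have hl : DifferentiableAt ℝ (c x).l x.1.1 :=
    ((c x).contDiffOn.contDiffAt ((c x).isOpen_U.mem_nhds hxU)).differentiableAt (by simp)
  have hmf : (mfderiv 𝓘(ℝ, 𝔼 n) (cotangentI n) (Subtype.val : L → CotangentBundle B) x :
      𝔼 n →L[ℝ] 𝔼 n × 𝔻 n) = (ContinuousLinearMap.id ℝ (𝔼 n)).prod (fderiv ℝ (c x).l x.1.1) := by
    have h1 := (himm.contMDiff.mdifferentiable (by simp) x).mfderiv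
    refine h1.trans ?_
    have h2 : HasFDerivAt (fun b => (b, (c x).l b))
        ((ContinuousLinearMap.id ℝ (𝔼 n)).prod (fderiv ℝ (c x).l x.1.1)) (x.1.1 : 𝔼 n) :=
      (hasFDerivAt_id _).prodMk hl.hasFDerivAt
    have h3 : writtenInExtChartAt 𝓘(ℝ, 𝔼 n) (cotangentI n) x
        (Subtype.val : L → CotangentBundle B) =ᶠ[𝓝 (x.1.1 : 𝔼 n)] fun b => (b, (c x).l b) := by
      filter_upwards [(c x).isOpen_U.mem_nhds hxU] with b hb
      change (((((c x).chart x).symm b).1.1 : 𝔼 n), (((c x).chart x).symm b).1.2) = _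
      rw [(c x).chart_symm_apply x hb]
      rfl
    have h4 := (h2.congr_of_eventuallyEq h3).hasFDerivWithinAt (s := Set.range 𝓘(ℝ, 𝔼 n))
    refine h4.fderivWithin ?_
    rw [modelWithCornersSelf_coe, Set.range_id]
    exact uniqueDiffWithinAt_univ
  have hrange : ∀ v : 𝔼 n × 𝔻 n, v ∈ LinearMap.range (mfderiv 𝓘(ℝ, 𝔼 n) (cotangentI n)
      (Subtype.val : L → CotangentBundle B) x).toLinearMap ↔
      v.2 = fderiv ℝ (c x).l x.1.1 v.1 := by
    intro v
    constructor
    · rintro ⟨u, rfl⟩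
      have h5 := congrArg (fun A : 𝔼 n →L[ℝ] 𝔼 n × 𝔻 n => A u) hmf
      exact ((congrArg Prod.snd h5).trans
        (congrArg (fun w => fderiv ℝ (c x).l x.1.1 w) (congrArg Prod.fst h5).symm))
    · intro h
      refine ⟨v.1, ?_⟩
      have h5 := congrArg (fun A : 𝔼 n →L[ℝ] 𝔼 n × 𝔻 n => A v.1) hmf
      exact h5.trans (Prod.ext rfl h.symm)
  intro v
  have hsymm := (c x).fderiv_symm x.1.1 hxU
  -- Symmetry of dl makes the graph of dl isotropic; conversely, pairing v with the graph vectors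
  -- (u, dl u) forces v.2 = dl v.1.
  constructor
  · intro hv w hw
    have hv' := (hrange v).1 hv
    have hw' := (hrange w).1 hw
    change w.2 v.1 - v.2 w.1 = 0
    rw [hv', hw', hsymm, sub_self]
  · intro h
    refine (hrange v).2 (ContinuousLinearMap.ext fun u => ?_)
    have h1 : (fderiv ℝ (c x).l x.1.1 u) v.1 - v.2 u = 0 :=
      h (u, fderiv ℝ (c x).l x.1.1 u) ((hrange _).2 rfl)
    rw [hsymm] at h1
    exact (sub_eq_zero.1 h1).symm

end Graph

/-! ### The period net is a closed Lagrangian submanifold. -/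

namespace LagrangianFibration

variable {n : ℕ} {B : Opens (𝔼 n)}
  {E : Type*} [NormedAddCommGroup E] [NormedSpace ℝ E]
  {M : Type*} [TopologicalSpace M] [ChartedSpace E M] [FiniteDimensional ℝ E]
  [T2Space M] [IsManifold 𝓘(ℝ, E) ∞ M] {F : LagrangianFibration B E M} (hF : F.IsComplete)

theorem exists_graphChart (hconn : ∀ b : B, IsConnected (F.proj ⁻¹' {b}))
    {ξ : CotangentBundle B} (h : ξ ∈ F.periodNet hF) :
    ∃ c : GraphChart (F.periodNet hF), ((ξ.1 : 𝔼 n), ξ.2) ∈ c.W := by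
  obtain ⟨l, U, W, hU, hW, hξ, hl, hWU, hUW, hiff⟩ :=
    exists_periodSet_eq_graph hF hconn ((mem_periodNet_iff hF hconn ξ).1 h)
  have hmem : ∀ b ∈ U, (b, l b) ∈ periodSet hF := fun b hb => (hiff _ (hUW b hb)).2 rfl
  refine ⟨⟨l, U, W, hU, hW, hl, hWU, hUW, ?_, ?_, ?_⟩, hξ⟩
  · intro b hb
    obtain ⟨x, rfl, -⟩ := hmem b hb
    exact (F.proj x).2
  · exact fun η hη => (mem_periodNet_iff hF hconn η).trans (hiff _ hη)
  · intro b hb v w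
    exact fderiv_symm_of_mem_periodSet hF hconn
      ((hl.contDiffAt (hU.mem_nhds hb)).differentiableAt (by simp))
      (Filter.eventually_of_mem (hU.mem_nhds hb) hmem) v w

theorem isLagrangianSubmanifold_periodNet (hconn : ∀ b : B, IsConnected (F.proj ⁻¹' {b})) :
    IsLagrangianSubmanifold (F.periodNet hF) := by
  choose c hc using fun x : F.periodNet hF => exists_graphChart hF hconn x.2
  exact isLagrangianSubmanifold_of_graphChart c hc

/-- Along a continuous local section s, non-periods are given by φ_β(s b) ≠ s b, an open condition
because M is Hausdorff. -/
theorem isClosed_periodNet (hconn : ∀ b : B, IsConnected (F.proj ⁻¹' {b})) :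
    IsClosed (F.periodNet hF) := by
  rw [← isOpen_compl_iff, isOpen_iff_mem_nhds]
  rintro ⟨b, β⟩ h
  obtain ⟨x, rfl⟩ := F.surjective b
  obtain ⟨s, hs, hsx, hsb⟩ := F.exists_section x
  have hmem : ∀ (y : M) (γ : 𝔻 n), (F.proj y, γ) ∈ F.periodNet hF ↔ F.timeOne hF γ y = y :=
    fun y γ => (mem_periodNet_iff hF hconn _).trans (mk_mem_periodSet_iff hF hconn y γ)
  have hne : F.timeOne hF β (s (F.base x)) ≠ s (F.base x) := by
    rw [hsx]
    exact fun h' => h ((hmem x β).2 h')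
  have hfst : Filter.Tendsto (fun ξ : CotangentBundle B => (ξ.1 : 𝔼 n)) (𝓝 (F.proj x, β))
      (𝓝 (F.base x)) :=
    (continuous_subtype_val.comp continuous_fst).continuousAt
  have h2 : ContinuousAt (fun ξ : CotangentBundle B => s ξ.1) (F.proj x, β) :=
    hs.continuousAt.tendsto.comp hfst
  have h1 : ContinuousAt (fun ξ : CotangentBundle B => F.timeOne hF ξ.2 (s ξ.1)) (F.proj x, β) :=
    ContinuousAt.comp (f := fun ξ : CotangentBundle B => (ξ.2, s ξ.1))
      (contMDiff_timeOne hF).continuous.continuousAt (continuousAt_snd.prodMk h2)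
  filter_upwards [(h1.prodMk h2).eventually_mem
    (isClosed_diagonal.isOpen_compl.mem_nhds hne), hfst.eventually hsb] with ξ hξ hξb hξL
  obtain ⟨b', γ⟩ := ξ
  have h3 : F.proj (s b') = b' := Subtype.ext hξb
  refine hξ ((hmem (s b') γ).1 ?_)
  rwa [h3]

end LagrangianFibration

/-! ### Smooth structures on quotients with smooth deck germs. -/

section Pushforward

variable {V : Type*} [NormedAddCommGroup V] [NormedSpace ℝ V] {H : Type*} [TopologicalSpace H]
  {I : ModelWithCorners ℝ V H} {X : Type*} [TopologicalSpace X] [ChartedSpace H X]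
  {Y : Type*} [TopologicalSpace Y] {f : X → Y}

/-- The points of each fibre of `f` are related by germs of smooth maps which preserve `f`. -/
def HasSmoothDeck (I : ModelWithCorners ℝ V H) (f : X → Y) : Prop :=
  ∀ x x', f x = f x' → ∃ φ : X → X, ContMDiffAt I I ∞ φ x ∧ φ x = x' ∧ ∀ᶠ z in 𝓝 x, f (φ z) = f z

/-- Near x, the local inverse h composed with f coincides with a deck germ φ, because φ z lies in
the sheet of h. -/
theorem HasSmoothDeck.contMDiffAt_comp (hd : HasSmoothDeck I f) {h : OpenPartialHomeomorph Y X}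
    (hf : h.symm = f) {x : X} (hx : f x ∈ h.source) : ContMDiffAt I I ∞ (fun z => h (f z)) x := by
  obtain ⟨φ, hφ, hφx, hφf⟩ := hd x (h (f x)) (by rw [← hf] at hx ⊢; exact (h.left_inv hx).symm)
  refine hφ.congr_of_eventuallyEq ?_
  have h1 : ∀ᶠ z in 𝓝 x, φ z ∈ h.target := by
    refine hφ.continuousAt.eventually_mem (h.open_target.mem_nhds ?_)
    rw [hφx]
    exact h.map_source hx
  filter_upwards [hφf, h1] with z hz hz'
  rw [← hz, ← hf, h.right_inv hz']

/-- A deck germ sends a neighbourhood of any point of the saturation of U into U, so the saturation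
is open. -/
theorem HasSmoothDeck.isOpenMap (hd : HasSmoothDeck I f) (hq : Topology.IsQuotientMap f) :
    IsOpenMap f := by
  intro U hU
  rw [← hq.isOpen_preimage, isOpen_iff_mem_nhds]
  rintro x ⟨x', hx', hxx'⟩
  obtain ⟨φ, hφ, hφx, hφf⟩ := hd x x' hxx'.symm
  have h1 : ∀ᶠ z in 𝓝 x, φ z ∈ U :=
    hφ.continuousAt.eventually_mem (hU.mem_nhds (hφx.symm ▸ hx'))
  filter_upwards [h1, hφf] with z hz hz'
  exact ⟨φ z, hz, hz'⟩

variable [IsManifold I ∞ X]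

/-- A transition map is h ∘ f, for a local inverse h, read in charts of X. -/
theorem HasSmoothDeck.isManifold (hd : HasSmoothDeck I f) (hf : IsLocalHomeomorph f) {g : Y → X}
    (hg : Function.RightInverse g f) :
    @IsManifold ℝ _ V _ _ H _ I ∞ Y _ (hf.chartedSpaceOfRightInverse (H := H) hg) := by
  let _ : ChartedSpace H Y := hf.chartedSpaceOfRightInverse hg
  refine isManifold_of_contDiffOn _ _ _ ?_
  rintro e e' ⟨q, rfl⟩ ⟨q', rfl⟩
  rw [← contMDiffOn_iff_contDiffOn]
  refine I.contMDiff.comp_contMDiffOn ?_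
  refine ContMDiffOn.comp (t := (((hf.localInverseAt (g q)).trans (chartAt H (g q))).symm.trans
    ((hf.localInverseAt (g q')).trans (chartAt H (g q')))).source) (I' := I) ?_
    (I.contMDiffOn_symm.mono Set.inter_subset_right) Set.inter_subset_left
  intro b hb
  refine ContMDiffAt.contMDiffWithinAt ?_
  have hb1 : b ∈ (chartAt H (g q)).target := hb.1.1
  have hs := hf.localInverseAt_symm (g q)
  have hb2 : f ((chartAt H (g q)).symm b) ∈ (hf.localInverseAt (g q')).source := by
    have := hb.2.1
    change (hf.localInverseAt (g q)).symm ((chartAt H (g q)).symm b) ∈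
      (hf.localInverseAt (g q')).source at this
    rwa [hs] at this
  have hb3 : hf.localInverseAt (g q') (f ((chartAt H (g q)).symm b)) ∈
      (chartAt H (g q')).source := by
    have := hb.2.2
    change hf.localInverseAt (g q') ((hf.localInverseAt (g q)).symm ((chartAt H (g q)).symm b)) ∈
      (chartAt H (g q')).source at this
    rwa [hs] at this
  have h1 : ContMDiffAt I I ∞ (chartAt H (g q)).symm b :=
    contMDiffAt_symm_of_mem_maximalAtlas (IsManifold.chart_mem_maximalAtlas _) hb1
  have h2 := hd.contMDiffAt_comp (hf.localInverseAt_symm (g q')) hb2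
  have h3 : ContMDiffAt I I ∞ (chartAt H (g q')) _ :=
    contMDiffAt_of_mem_maximalAtlas (IsManifold.chart_mem_maximalAtlas _) hb3
  have h4 := ContMDiffAt.comp b (ContMDiffAt.comp _ h3 h2) h1
  refine h4.congr_of_eventuallyEq (Filter.Eventually.of_forall fun c => ?_)
  change chartAt H (g q') (hf.localInverseAt (g q')
    ((hf.localInverseAt (g q)).symm ((chartAt H (g q)).symm c))) = _
  rw [hs]
  rfl

/-- Both f and its local inverses, read in the charts of Y, again reduce to compositions h ∘ f. -/
theorem HasSmoothDeck.isLocalDiffeomorph (hd : HasSmoothDeck I f) (hf : IsLocalHomeomorph f)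
    {g : Y → X} (hg : Function.RightInverse g f) :
    @IsLocalDiffeomorph ℝ _ V _ _ V _ _ H _ H _ I I X _ _ Y _
      (hf.chartedSpaceOfRightInverse (H := H) hg) ∞ f := by
  let _ : ChartedSpace H Y := hf.chartedSpaceOfRightInverse hg
  have := hd.isManifold hf hg
  have hsrc : ∀ y, y ∈ (hf.localInverseAt (g y)).source ∧
      hf.localInverseAt (g y) y ∈ (chartAt H (g y)).source := fun y => mem_chart_source H y
  have hsmooth : ContMDiff I I ∞ f := by
    intro x
    let x₀ := g (f x)
    obtain ⟨h1, h2⟩ := hsrc (f x)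
    have h3 := hd.contMDiffAt_comp (hf.localInverseAt_symm x₀) h1
    have h4 : ContMDiffAt I I ∞ (chartAt H x₀) (hf.localInverseAt x₀ (f x)) :=
      contMDiffAt_of_mem_maximalAtlas (IsManifold.chart_mem_maximalAtlas _) h2
    have h5 : ContMDiffAt I I ∞ (fun z => chartAt H (f x) (f z)) x :=
      ContMDiffAt.comp (g := chartAt H x₀) (f := fun z => hf.localInverseAt x₀ (f z)) x h4 h3
    have h6 : ContMDiffAt I I ∞ (chartAt H (f x)).symm (chartAt H (f x) (f x)) :=
      contMDiffAt_symm_of_mem_maximalAtlas (IsManifold.chart_mem_maximalAtlas _)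
        (mem_chart_target _ _)
    refine (ContMDiffAt.comp x h6 h5).congr_of_eventuallyEq ?_
    filter_upwards [hf.continuous.continuousAt.eventually_mem
      ((chartAt H (f x)).open_source.mem_nhds (mem_chart_source H (f x)))] with z hz
    exact ((chartAt H (f x)).left_inv hz).symm
  have hinv : ∀ x, ContMDiffOn I I ∞ (hf.localInverseAt x) (hf.localInverseAt x).source := by
    intro x y hy
    refine ContMDiffAt.contMDiffWithinAt ?_
    let x₀ := g y
    obtain ⟨h1, h2⟩ := hsrc y
    have h3 : ContMDiffAt I I ∞ (chartAt H y) y :=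
      contMDiffAt_of_mem_maximalAtlas (IsManifold.chart_mem_maximalAtlas _) (mem_chart_source _ _)
    have h4 : ContMDiffAt I I ∞ (chartAt H x₀).symm (chartAt H y y) :=
      contMDiffAt_symm_of_mem_maximalAtlas (IsManifold.chart_mem_maximalAtlas _)
        ((chartAt H x₀).map_source h2)
    have h5 : (chartAt H x₀).symm (chartAt H y y) = hf.localInverseAt x₀ y :=
      (chartAt H x₀).left_inv h2
    have h6 : f ((chartAt H x₀).symm (chartAt H y y)) = y := by
      rw [h5]
      exact hf.apply_localInverseAt_of_mem h1
    have h7 := hd.contMDiffAt_comp (hf.localInverseAt_symm x)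
      (x := (chartAt H x₀).symm (chartAt H y y)) (h6.symm ▸ hy)
    refine (ContMDiffAt.comp y h7 (ContMDiffAt.comp y h4 h3)).congr_of_eventuallyEq ?_
    filter_upwards [(chartAt H y).open_source.mem_nhds (mem_chart_source H y)] with z hz
    have h8 : (chartAt H x₀).symm (chartAt H y z) = hf.localInverseAt x₀ z :=
      (chartAt H x₀).left_inv hz.2
    change _ = hf.localInverseAt x (f ((chartAt H x₀).symm (chartAt H y z)))
    rw [h8, hf.apply_localInverseAt_of_mem hz.1]
  intro x
  have hs := hf.localInverseAt_symm x
  refine ⟨⟨(hf.localInverseAt x).symm.toPartialEquiv, (hf.localInverseAt x).open_target,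
    (hf.localInverseAt x).open_source, ?_, hinv x⟩, hf.self_mem_localInverseAt_target, ?_⟩
  · change ContMDiffOn I I ∞ (hf.localInverseAt x).symm _
    rw [hs]
    exact hsmooth.contMDiffOn
  · intro z _
    exact (congrFun hs z).symm

end Pushforward

theorem isLocalHomeomorph_of_isOpenMap {X Y : Type*} [TopologicalSpace X] [TopologicalSpace Y]
    {f : X → Y} (hc : Continuous f) (ho : IsOpenMap f)
    (hi : ∀ x, ∃ U ∈ 𝓝 x, U.InjOn f) : IsLocalHomeomorph f := by
  refine isLocalHomeomorph_iff_isOpenEmbedding_restrict.2 fun x => ?_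
  obtain ⟨U, hU, hinj⟩ := hi x
  obtain ⟨O, hOU, hO, hxO⟩ := mem_nhds_iff.1 hU
  refine ⟨O, hO.mem_nhds hxO, ?_⟩
  exact .of_continuous_injective_isOpenMap (hc.comp continuous_subtype_val)
    (Set.injOn_iff_injective.1 (hinj.mono hOU)) (ho.comp hO.isOpenMap_subtype_val)

/-! ### The quotient of the cotangent bundle by the periods. -/

namespace LagrangianFibration

variable {n : ℕ} {B : Opens (𝔼 n)}
  {E : Type*} [NormedAddCommGroup E] [NormedSpace ℝ E]
  {M : Type*} [TopologicalSpace M] [ChartedSpace E M] [FiniteDimensional ℝ E]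
  [T2Space M] [IsManifold 𝓘(ℝ, E) ∞ M] {F : LagrangianFibration B E M} (hF : F.IsComplete)

theorem mem_periodLattice_iff_timeOne_eq (hconn : ∀ b : B, IsConnected (F.proj ⁻¹' {b})) (x : M)
    (β : 𝔻 n) : β ∈ F.periodLattice hF (F.proj x) ↔ F.timeOne hF β x = x :=
  (mem_periodLattice_iff hF hconn _ β).trans (mk_mem_periodSet_iff hF hconn x β)

/-- The periods over a point form a group. -/
def periodSubgroup (hconn : ∀ b : B, IsConnected (F.proj ⁻¹' {b})) (b : B) :
    AddSubgroup (𝔻 n) where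
  carrier := F.periodLattice hF b
  zero_mem' := by
    obtain ⟨x, rfl⟩ := F.surjective b
    exact (mem_periodLattice_iff_timeOne_eq hF hconn x 0).2 (timeOne_zero hF x)
  add_mem' {β γ} hβ hγ := by
    obtain ⟨x, rfl⟩ := F.surjective b
    rw [mem_periodLattice_iff_timeOne_eq hF hconn] at hβ hγ ⊢
    rw [timeOne_add, hγ, hβ]
  neg_mem' {β} hβ := by
    obtain ⟨x, rfl⟩ := F.surjective b
    rw [mem_periodLattice_iff_timeOne_eq hF hconn] at hβ ⊢
    conv_lhs => rw [← hβ]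
    exact timeOne_neg_timeOne hF β x

theorem equivalence_periodRel (hconn : ∀ b : B, IsConnected (F.proj ⁻¹' {b})) :
    Equivalence (F.PeriodRel hF) where
  refl ξ := ⟨rfl, by rw [sub_self]; exact (periodSubgroup hF hconn ξ.1).zero_mem⟩
  symm {ξ η} h := ⟨h.1.symm, by
    rw [← h.1, ← neg_sub]
    exact (periodSubgroup hF hconn ξ.1).neg_mem h.2⟩
  trans {ξ η ζ} h h' := ⟨h.1.trans h'.1, by
    have h2 := h'.2
    rw [← h.1] at h2
    rw [← sub_add_sub_cancel ξ.2 η.2 ζ.2]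
    exact (periodSubgroup hF hconn ξ.1).add_mem h.2 h2⟩

theorem mk_periodRel_eq_iff (hconn : ∀ b : B, IsConnected (F.proj ⁻¹' {b}))
    (ξ η : CotangentBundle B) :
    Quot.mk (F.PeriodRel hF) ξ = Quot.mk (F.PeriodRel hF) η ↔ F.PeriodRel hF ξ η :=
  (equivalence_periodRel hF hconn).quot_mk_eq_iff ξ η

/-- Λ is the graph of a smooth l near the period β' − β; the deck germ is the translation (b, β) ↦
(b, β + l b). -/
theorem hasSmoothDeck_mk (hconn : ∀ b : B, IsConnected (F.proj ⁻¹' {b})) :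
    HasSmoothDeck (cotangentI n)
      (Quot.mk (F.PeriodRel hF) : CotangentBundle B → F.PeriodQuotient hF) := by
  rintro ⟨b, β⟩ ⟨b', β'⟩ h
  obtain ⟨hb, hβ⟩ := (equivalence_periodRel hF hconn).symm ((mk_periodRel_eq_iff hF hconn _ _).1 h)
  obtain rfl : b' = b := hb
  obtain ⟨c, hc⟩ := exists_graphChart hF hconn (ξ := (b', β' - β)) hβ
  have hl0 : β' - β = c.l b' := (c.mem_iff (b', β' - β) hc).1 hβ
  have hU : (b' : 𝔼 n) ∈ c.U := c.fst_mem _ hc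
  refine ⟨fun ξ => (ξ.1, ξ.2 + c.l ξ.1), ?_, ?_, ?_⟩
  · have h1 : ContMDiffAt (cotangentI n) 𝓘(ℝ, 𝔼 n) ∞
        (fun ξ : CotangentBundle B => (ξ.1 : 𝔼 n)) (b', β) :=
      ContMDiffAt.comp (b', β) (f := Prod.fst) contMDiff_subtype_val.contMDiffAt contMDiffAt_fst
    have h2 : ContMDiffAt (cotangentI n) 𝓘(ℝ, 𝔻 n) ∞
        (fun ξ : CotangentBundle B => c.l ξ.1) (b', β) :=
      ContMDiffAt.comp (b', β) (f := fun ξ : CotangentBundle B => (ξ.1 : 𝔼 n))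
        (c.contDiffOn.contDiffAt (c.isOpen_U.mem_nhds hU)).contMDiffAt h1
    exact contMDiffAt_fst.prodMk (contMDiffAt_snd.add h2)
  · refine Prod.ext rfl ?_
    change β + c.l b' = β'
    rw [← hl0, add_sub_cancel]
  · have h1 : ∀ᶠ ξ : CotangentBundle B in 𝓝 (b', β), (ξ.1 : 𝔼 n) ∈ c.U :=
      (continuous_subtype_val.comp continuous_fst).continuousAt.eventually_mem
        (c.isOpen_U.mem_nhds hU)
    filter_upwards [h1] with ξ hξ
    refine Quot.sound ⟨rfl, ?_⟩
    rw [add_sub_cancel_left]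
    exact (c.mem_iff (ξ.1, c.l ξ.1) (c.mk_mem _ hξ)).2 rfl

theorem isOpenQuotientMap_mk (hconn : ∀ b : B, IsConnected (F.proj ⁻¹' {b})) :
    IsOpenQuotientMap (Quot.mk (F.PeriodRel hF) : CotangentBundle B → F.PeriodQuotient hF) :=
  ⟨Quot.mk_surjective, continuous_quot_mk,
    (hasSmoothDeck_mk hF hconn).isOpenMap isQuotientMap_quot_mk⟩

/-- Near a point of the zero section Λ is the graph of some l. Zero is always a period, so l = 0
there, and equivalent covectors close enough to each other coincide. -/
theorem isLocalHomeomorph_mk (hconn : ∀ b : B, IsConnected (F.proj ⁻¹' {b})) :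
    IsLocalHomeomorph
      (Quot.mk (F.PeriodRel hF) : CotangentBundle B → F.PeriodQuotient hF) := by
  refine isLocalHomeomorph_of_isOpenMap continuous_quot_mk
    (isOpenQuotientMap_mk hF hconn).isOpenMap ?_
  rintro ⟨b, β⟩
  obtain ⟨c, hc⟩ := exists_graphChart hF hconn (ξ := (b, 0)) (periodSubgroup hF hconn b).zero_mem
  have h1 : ContinuousAt (fun q : CotangentBundle B × CotangentBundle B =>
      ((q.1.1 : 𝔼 n), q.1.2 - q.2.2)) ((b, β), (b, β)) :=
    (by fun_prop : Continuous (fun q : CotangentBundle B × CotangentBundle B =>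
      ((q.1.1 : 𝔼 n), q.1.2 - q.2.2))).continuousAt
  have h2 : ∀ᶠ q in 𝓝 (((b, β), (b, β)) : CotangentBundle B × CotangentBundle B),
      ((q.1.1 : 𝔼 n), q.1.2 - q.2.2) ∈ c.W :=
    h1.eventually_mem (c.isOpen_W.mem_nhds (by simpa using hc))
  rw [nhds_prod_eq] at h2
  obtain ⟨U, hU, hUW⟩ := (Filter.eventually_prod_self_iff
    (r := fun ξ η : CotangentBundle B => ((ξ.1 : 𝔼 n), ξ.2 - η.2) ∈ c.W)).1 h2
  refine ⟨U, hU, fun ξ hξ η hη h => ?_⟩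
  obtain ⟨h3, h4⟩ := (mk_periodRel_eq_iff hF hconn ξ η).1 h
  have h5 : ξ.2 - η.2 = c.l ξ.1 := (c.mem_iff (ξ.1, ξ.2 - η.2) (hUW _ hξ _ hη)).1 h4
  have h6 := hUW _ hξ _ hξ
  simp only [sub_self] at h6
  have h7 : (0 : 𝔻 n) = c.l ξ.1 :=
    (c.mem_iff (ξ.1, 0) h6).1 (periodSubgroup hF hconn ξ.1).zero_mem
  rw [← h7, sub_eq_zero] at h5
  exact Prod.ext h3 h5

/-- For an open quotient map, Hausdorffness means that the relation is closed; it is cut out by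
equality of base points and by the closed set Λ. -/
theorem t2Space_periodQuotient (hconn : ∀ b : B, IsConnected (F.proj ⁻¹' {b})) :
    T2Space (F.PeriodQuotient hF) := by
  rw [t2Space_iff_of_isOpenQuotientMap (isOpenQuotientMap_mk hF hconn)]
  simp only [mk_periodRel_eq_iff hF hconn]
  have h1 : IsClosed {q : CotangentBundle B × CotangentBundle B | q.1.1 = q.2.1} :=
    isClosed_eq (by fun_prop) (by fun_prop)
  have h2 := (isClosed_periodNet hF hconn).preimage (by fun_prop :
    Continuous fun q : CotangentBundle B × CotangentBundle B => (q.1.1, q.1.2 - q.2.2))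
  exact h1.inter h2

theorem secondCountableTopology_periodQuotient (hconn : ∀ b : B, IsConnected (F.proj ⁻¹' {b})) :
    SecondCountableTopology (F.PeriodQuotient hF) := by
  have : ProperSpace (𝔻 n) := FiniteDimensional.proper ℝ _
  have : SecondCountableTopology (𝔻 n) := inferInstance
  exact (isOpenQuotientMap_mk hF hconn).isQuotientMap.secondCountableTopology
    (isOpenQuotientMap_mk hF hconn).isOpenMap

end LagrangianFibration

end

theorem mainTheorem6 {n : ℕ} (B : Opens (EuclideanSpace ℝ (Fin n)))
    {E : Type*} [NormedAddCommGroup E] [NormedSpace ℝ E] [FiniteDimensional ℝ E]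
    {M : Type*} [TopologicalSpace M] [T2Space M] [SecondCountableTopology M]
    [ChartedSpace E M] [IsManifold 𝓘(ℝ, E) ∞ M]
    (F : LagrangianFibration B E M) (hF : F.IsComplete)
    (hconn : ∀ b : B, IsConnected (F.proj ⁻¹' {b})) :
    (IsClosed (F.periodNet hF) ∧ IsLagrangianSubmanifold (F.periodNet hF)) ∧
    (Equivalence (F.PeriodRel hF) ∧
      T2Space (F.PeriodQuotient hF) ∧ SecondCountableTopology (F.PeriodQuotient hF) ∧
      ∃ _ : ChartedSpace (CotangentModel n) (F.PeriodQuotient hF),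
        IsManifold (cotangentI n) ∞ (F.PeriodQuotient hF) ∧
        IsLocalDiffeomorph (cotangentI n) (cotangentI n) ∞
          (Quot.mk (F.PeriodRel hF) : CotangentBundle B → F.PeriodQuotient hF)) :=
  ⟨⟨LagrangianFibration.isClosed_periodNet hF hconn,
      LagrangianFibration.isLagrangianSubmanifold_periodNet hF hconn⟩,
    LagrangianFibration.equivalence_periodRel hF hconn,
    LagrangianFibration.t2Space_periodQuotient hF hconn,
    LagrangianFibration.secondCountableTopology_periodQuotient hF hconn,
    (LagrangianFibration.isLocalHomeomorph_mk hF hconn).chartedSpaceOfRightInverse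
      (Function.rightInverse_surjInv Quot.mk_surjective),
    (LagrangianFibration.hasSmoothDeck_mk hF hconn).isManifold _ _,
    (LagrangianFibration.hasSmoothDeck_mk hF hconn).isLocalDiffeomorph _ _⟩
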